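/- Let $p\in\mathbb C$ with $0<|p|<1$, and put $\theta_p(z)=\prod_{k\ge 0}(1-p^kz)(1-p^{k+1}/z)$ and $\theta_p(a,b)=\theta_p(a)\theta_p(b)$. Let $m\ge 0$, and let $u_0,\dots,u_{2m+5}\in\mathbb C^*$ be pairwise distinct modulo $p^{\mathbb Z}$. Choose $L$ with $L^2=\prod_{j=0}^{2m+5}u_j$. Let $(x_k,y_k)\in\mathbb C^2$ for $0\le k\le 2m+2$. For $S\subset\mathbb Z_{2m+3}=\{0,\dots,2m+2\}$ let $\bar S$ be its complement, $u_S=\prod_{i\in S}u_i$, $x_S=\prod_{i\in S}x_i$, $y_S=\prod_{i\in S}y_i$, and $W_S=\prod_{i\in S,\,j\notin S}u_j^{-1}\theta_p(u_i/u_j)^{-1}$. For $w\in\{u_{2m+4},u_{2m+5}\}$ put $$F_w(z)=\frac{\theta_p(z/w)}{\theta_p(u_{2m+3}/w)}\sum_{|S|=m+1}\frac{x_Sy_{\bar S}}{u_{\bar S}w}\,\theta_p\!\left(\frac{u_Swz}{L},\frac{u_{\bar S}w}{L}\right)\prod_{i\in S}\theta_p\!\left(\frac z{u_i}\right)W_S,$$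 $$G_w(z)=\frac{\theta_p(z/w)}{\theta_p(u_{2m+3}/w)}\sum_{|S|=m+2}\frac{(-1)^mx_Sy_{\bar S}}{u_Sw}\,\theta_p\!\left(\frac{wu_S}{L},\frac{wzu_{\bar S}}{L}\right)\prod_{i\notin S}\theta_p\!\left(\frac z{u_i}\right)W_S,$$ $$B(z)=\begin{pmatrix}F_{u_{2m+4}}(z)&G_{u_{2m+4}}(z)\\ F_{u_{2m+5}}(z)&G_{u_{2m+5}}(z)\end{pmatrix}.$$ Let $V$ be the space of holomorphic functions $f$ on $\mathbb C^*$ with $f(pz)=(-1)^{m+3}Lz^{-(m+3)}f(z)$. For a $2\times2$ matrix $M(z)$ with entries in $V$ consider the properties: (A1) $\det M(u_k)=0$ for $0\le k\le 2m+5$, and $\det M$ is not identically zero; (A2) $\ker M(u_k)=\langle(x_k,y_k)\rangle$ for $0\le k\le 2m+2$; (A3) the images of $M(u_{2m+3})$, $M(u_{2m+4})$, $M(u_{2m+5})$ are $\langle(1,1)\rangle$, $\langle(0,1)\rangle$, $\langle(1,0)\rangle$ respectively. Then: 1. The entries of $B(z)$ lie in $V$, and for the given $u_k$ and $L$, $\det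 B(z)$ is not identically zero for generic $(x_k,y_k)_k$: the set of $(x,y)\in\mathbb C^{2m+3}\times\mathbb C^{2m+3}$ for which $\det B\not\equiv 0$ is the complement of the zero set of a nonzero polynomial. 2. Whenever $\det B\not\equiv0$, the matrix $B(z)$ has the properties (A1), (A2) and (A3), and the zeros of $\det B$ in $\mathbb C^*$ are exactly the points $p^nu_k$ with $n\in\mathbb Z$, $0\le k\le 2m+5$. 3. For every choice of $(x_k,y_k)_k$, if $M(z)$ and $N(z)$ are matrices with entries in $V$ that both satisfy (A1), (A2) and (A3), then $N=cM$ for some constant $c\in\mathbb C^*$. Consequently $A(z)=M(\eta/(qz))^{-1}M(z)$ (for any $q,\eta\in\mathbb C^*$) is uniquely determined by (A1), (A2) and (A3). -/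

import Mathlib

open scoped BigOperators

noncomputable section

namespace EllipticGarnier

/-- The infinite `p`-Pochhammer symbol `(z;p)_∞ = ∏_{k ≥ 0} (1 - p^k z)` (convergent for `|p| < 1`). -/
def pochInf (p z : ℂ) : ℂ := ∏' k : ℕ, (1 - p ^ k * z)

/-- The theta function `θ_p(z) = (z;p)_∞ (p/z;p)_∞`. -/
def theta (p z : ℂ) : ℂ := pochInf p z * pochInf p (p / z)

/-- The inclusion of the index set `ℤ_{2m+3} = {0, …, 2m+2}` into `{0, …, 2m+5}`. -/
def emb (m : ℕ) (i : Fin (2 * m + 3)) : Fin (2 * m + 6) := Fin.castLE (by omega) i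

/-- The index `2m+3`. -/
def i3 (m : ℕ) : Fin (2 * m + 6) := ⟨2 * m + 3, by omega⟩

/-- The index `2m+4`. -/
def i4 (m : ℕ) : Fin (2 * m + 6) := ⟨2 * m + 4, by omega⟩

/-- The index `2m+5`. -/
def i5 (m : ℕ) : Fin (2 * m + 6) := ⟨2 * m + 5, by omega⟩

/-- `u_S = ∏_{i ∈ S} u_i` for `S ⊆ ℤ_{2m+3}`. -/
def uProd {m : ℕ} (u : Fin (2 * m + 6) → ℂ) (S : Finset (Fin (2 * m + 3))) : ℂ :=
  ∏ i ∈ S, u (emb m i)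

/-- `∏_{i ∈ S, j ∉ S} u_j⁻¹ θ_p(u_i / u_j)⁻¹`. -/
def weight (p : ℂ) {m : ℕ} (u : Fin (2 * m + 6) → ℂ) (S : Finset (Fin (2 * m + 3))) : ℂ :=
  ∏ i ∈ S, ∏ j ∈ Sᶜ, (u (emb m j))⁻¹ * (theta p (u (emb m i) / u (emb m j)))⁻¹

/-- The common form of the two entries in the first column: `B₁₁(z)` is the case `w = u_{2m+4}` and
`B₂₁(z)` is the case `w = u_{2m+5}`. -/
def firstCol (p : ℂ) {m : ℕ} (u : Fin (2 * m + 6) → ℂ) (L : ℂ) (x y : Fin (2 * m + 3) → ℂ)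
    (w z : ℂ) : ℂ :=
  theta p (z / w) / theta p (u (i3 m) / w) *
    ∑ S ∈ Finset.powersetCard (m + 1) (Finset.univ : Finset (Fin (2 * m + 3))),
      (∏ i ∈ S, x i) * (∏ i ∈ Sᶜ, y i) / (uProd u Sᶜ * w) *
        (theta p (uProd u S * w * z / L) * theta p (uProd u Sᶜ * w / L)) *
        (∏ i ∈ S, theta p (z / u (emb m i))) * weight p u S

/-- The common form of the two entries in the second column: `B₁₂(z)` is the case `w = u_{2m+4}` and
`B₂₂(z)` is the case `w = u_{2m+5}`. -/
def secondCol (p : ℂ) {m : ℕ} (u : Fin (2 * m + 6) → ℂ) (L : ℂ) (x y : Fin (2 * m + 3) → ℂ)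
    (w z : ℂ) : ℂ :=
  theta p (z / w) / theta p (u (i3 m) / w) *
    ∑ S ∈ Finset.powersetCard (m + 2) (Finset.univ : Finset (Fin (2 * m + 3))),
      (-1) ^ m * (∏ i ∈ S, x i) * (∏ i ∈ Sᶜ, y i) / (uProd u S * w) *
        (theta p (w * uProd u S / L) * theta p (w * z * uProd u Sᶜ / L)) *
        (∏ i ∈ Sᶜ, theta p (z / u (emb m i))) * weight p u S

/-- The explicit matrix `B(z)`. -/
def matB (p : ℂ) {m : ℕ} (u : Fin (2 * m + 6) → ℂ) (L : ℂ) (x y : Fin (2 * m + 3) → ℂ)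
    (z : ℂ) : Matrix (Fin 2) (Fin 2) ℂ :=
  !![firstCol p u L x y (u (i4 m)) z, secondCol p u L x y (u (i4 m)) z;
     firstCol p u L x y (u (i5 m)) z, secondCol p u L x y (u (i5 m)) z]

/-- The entries of `M` are holomorphic theta functions on `ℂ*` with the fixed multiplier
`f(pz) = (-1)^{m+3} L z^{-(m+3)} f(z)`. -/
def IsThetaMatrix (p : ℂ) (m : ℕ) (L : ℂ) (M : ℂ → Matrix (Fin 2) (Fin 2) ℂ) : Prop :=
  ∀ i j : Fin 2, DifferentiableOn ℂ (fun z => M z i j) {0}ᶜ ∧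
    ∀ z : ℂ, z ≠ 0 → M (p * z) i j = (-1) ^ (m + 3) * L / z ^ (m + 3) * M z i j

/-- The determinant of `M(z)` is not identically zero on `ℂ*`. -/
def DetNonzero (M : ℂ → Matrix (Fin 2) (Fin 2) ℂ) : Prop :=
  ∃ z : ℂ, z ≠ 0 ∧ (M z).det ≠ 0

/-- Property (A1): the determinant vanishes at `u_0, …, u_{2m+5}` and is not identically zero. -/
def PropA1 {m : ℕ} (u : Fin (2 * m + 6) → ℂ) (M : ℂ → Matrix (Fin 2) (Fin 2) ℂ) : Prop :=
  (∀ k, (M (u k)).det = 0) ∧ DetNonzero M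

/-- Property (A2): the kernel of `M(u_k)` is `⟨(x_k, y_k)⟩` for `0 ≤ k ≤ 2m+2`. -/
def PropA2 {m : ℕ} (u : Fin (2 * m + 6) → ℂ) (x y : Fin (2 * m + 3) → ℂ)
    (M : ℂ → Matrix (Fin 2) (Fin 2) ℂ) : Prop :=
  ∀ k : Fin (2 * m + 3),
    LinearMap.ker (M (u (emb m k))).mulVecLin = Submodule.span ℂ {![x k, y k]}

/-- Property (A3): the images of `M(z)` at `z = u_{2m+3}, u_{2m+4}, u_{2m+5}` are
`⟨(1,1)⟩`, `⟨(0,1)⟩`, `⟨(1,0)⟩`. -/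
def PropA3 {m : ℕ} (u : Fin (2 * m + 6) → ℂ) (M : ℂ → Matrix (Fin 2) (Fin 2) ℂ) : Prop :=
  LinearMap.range (M (u (i3 m))).mulVecLin = Submodule.span ℂ {![1, 1]} ∧
  LinearMap.range (M (u (i4 m))).mulVecLin = Submodule.span ℂ {![0, 1]} ∧
  LinearMap.range (M (u (i5 m))).mulVecLin = Submodule.span ℂ {![1, 0]}

/-- The matrix `A(z) = B(η/(qz))⁻¹ B(z)` attached to `B(z)`. -/
def matA (q η : ℂ) (M : ℂ → Matrix (Fin 2) (Fin 2) ℂ) (z : ℂ) : Matrix (Fin 2) (Fin 2) ℂ :=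
  (M (η / (q * z)))⁻¹ * M z

end EllipticGarnier

end

/-! Everything rests on counting zeros of theta functions. A holomorphic `f` on `ℂ*` with `f(pz) =
(-1)^n t z^{-n} f(z)`, `t ≠ 0`, is divisible by `θ(z/a)` whenever `f(a) = 0`, and the quotient has
degree `n-1` and parameter `t/a`; in degree 0 with `‖t‖ = 1` Liouville makes `f` constant. Hence a
function of degree `n` whose parameter is the product of `n` inequivalent points, and which vanishes
at all but one of them, is a multiple of the product of the corresponding thetas
(`IsTheta.eq_const_mul_prod`). Since `L² = ∏ u_j`, this applies to every difference of products of
two elements of `V`, in particular to determinants, so under (A1) `det M = C ∏ θ(z/u_j)` has simple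
zeros and no `M(u_k)` is zero.

Uniqueness: the entries of `N · adj M` satisfy the same criterion, because (A2) and (A3) give enough
zeros. So `N · adj M` is a constant matrix times `∏ θ(z/u_j)`, hence `C N = K M` with `K` constant,
and the three images in (A3) make `K` scalar (`exists_eq_smul_of_props`).

For `B`: at `u_k` the summands of the two columns cancel in pairs `S`, `S ∪ {k}`
(`summand_add_summand_insert`); at the last two points a prefactor kills a row; at `u_{2m+3}` the
two rows agree by `L² = ∏ u_j`. Thus `det B` is `C(x,y) ∏ θ(z/u_j)`, and nonvanishing is decided by
its value at one point off the zeros, a polynomial in `(x,y)`. That polynomial is nonzero because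
indicator vectors isolate one summand per column, leaving a theta determinant that can be checked by
hand (`exists_detNonzero_matB`). -/

noncomputable section

namespace EllipticGarnier

open Filter Topology Set

/-! ### The theta function: functional equations, zeros and their simplicity. -/

lemma summable_norm_pow_mul {p : ℂ} (hp1 : ‖p‖ < 1) (z : ℂ) :
    Summable fun k : ℕ => ‖-(p ^ k * z)‖ := by
  simpa using (summable_geometric_of_lt_one (norm_nonneg p) hp1).mul_right ‖z‖

lemma multipliable_pochInf {p : ℂ} (hp1 : ‖p‖ < 1) (z : ℂ) :
    Multipliable fun k : ℕ => (1 - p ^ k * z) := by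
  simpa [sub_eq_add_neg] using multipliable_one_add_of_summable (summable_norm_pow_mul hp1 z)

lemma pochInf_eq_mul {p : ℂ} (hp1 : ‖p‖ < 1) (z : ℂ) :
    pochInf p z = (1 - z) * pochInf p (p * z) := by
  have e : (fun k : ℕ => 1 - p ^ (k + 1) * z) = fun k : ℕ => 1 - p ^ k * (p * z) := by
    funext k; ring
  have h := tprod_eq_zero_mul' (f := fun k : ℕ => 1 - p ^ k * z)
    (by simp only [e]; exact multipliable_pochInf hp1 (p * z))
  simp only [e, pow_zero, one_mul] at h
  exact h

lemma pochInf_ne_zero {p : ℂ} (hp1 : ‖p‖ < 1) {z : ℂ} (hz : ∀ k : ℕ, p ^ k * z ≠ 1) :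
    pochInf p z ≠ 0 := by
  have := tprod_one_add_ne_zero_of_summable (f := fun k : ℕ => -(p ^ k * z))
    (fun k h => hz k (by linear_combination -h)) (summable_norm_pow_mul hp1 z)
  simpa [pochInf, sub_eq_add_neg] using this

lemma differentiable_pochInf {p : ℂ} (hp1 : ‖p‖ < 1) : Differentiable ℂ (pochInf p) := by
  have key : HasProdLocallyUniformlyOn (fun (k : ℕ) (z : ℂ) => 1 + -(p ^ k * z))
      (fun z => ∏' k : ℕ, (1 + -(p ^ k * z))) univ := by
    apply hasProdLocallyUniformlyOn_of_forall_compact isOpen_univ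
    intro K _ hcK
    obtain ⟨C, hC⟩ := hcK.isBounded.exists_norm_le
    refine ((summable_geometric_of_lt_one (norm_nonneg p) hp1).mul_right C).hasProdUniformlyOn_nat_one_add
      hcK (.of_forall fun n x hx ↦ ?_) (fun _ ↦ by fun_prop)
    simpa using mul_le_mul_of_nonneg_left (hC x hx) (pow_nonneg (norm_nonneg p) n)
  have hd := key.differentiableOn (.of_forall fun _ ↦ by
    simpa [Finset.prod_fn] using DifferentiableOn.finsetProd (fun _ _ ↦ by fun_prop)) isOpen_univ
  have : pochInf p = fun z => ∏' k : ℕ, (1 + -(p ^ k * z)) := by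
    funext z; simp [pochInf, sub_eq_add_neg]
  rw [this]
  exact differentiableOn_univ.1 hd

/-- Isolates the zero at `z = 1`; the remaining factor is symmetric under `z ↦ 1/z`, which yields
the inversion formula at once. -/
lemma theta_eq_sub_mul {p : ℂ} (hp1 : ‖p‖ < 1) (z : ℂ) :
    theta p z = (1 - z) * (pochInf p (p * z) * pochInf p (p / z)) := by
  rw [theta, pochInf_eq_mul hp1 z, mul_assoc]

lemma theta_inv {p : ℂ} (hp1 : ‖p‖ < 1) {z : ℂ} (hz : z ≠ 0) :
    theta p z⁻¹ = -z⁻¹ * theta p z := by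
  rw [theta_eq_sub_mul hp1, theta_eq_sub_mul hp1, div_inv_eq_mul, div_eq_mul_inv]
  field_simp
  ring

lemma theta_mul_left {p : ℂ} (hp0 : p ≠ 0) (hp1 : ‖p‖ < 1) {z : ℂ} (hz : z ≠ 0) :
    theta p (p * z) = -z⁻¹ * theta p z := by
  rw [← theta_inv hp1 hz, theta, theta, div_mul_cancel_left₀ hp0, div_inv_eq_mul, mul_comm]

lemma theta_swap {p : ℂ} (hp1 : ‖p‖ < 1) {a b : ℂ} (ha : a ≠ 0) (hb : b ≠ 0) :
    theta p (a / b) = -(a / b) * theta p (b / a) := by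
  rw [← inv_div b a, theta_inv hp1 (div_ne_zero hb ha)]

lemma differentiableOn_theta {p : ℂ} (hp1 : ‖p‖ < 1) : DifferentiableOn ℂ (theta p) {0}ᶜ := by
  have h := differentiable_pochInf hp1
  intro z hz
  have hz : z ≠ 0 := hz
  apply DifferentiableAt.differentiableWithinAt
  unfold theta
  refine (h z).mul ((h (p / z)).comp z ?_)
  exact (differentiableAt_const p).div differentiableAt_id hz

lemma theta_one {p : ℂ} (hp1 : ‖p‖ < 1) : theta p 1 = 0 := by
  simp [theta_eq_sub_mul hp1]

lemma theta_zpow {p : ℂ} (hp0 : p ≠ 0) (hp1 : ‖p‖ < 1) (n : ℤ) : theta p (p ^ n) = 0 := by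
  have step : ∀ n : ℤ, theta p (p ^ (n + 1)) = 0 ↔ theta p (p ^ n) = 0 := fun n => by
    have hz : p ^ n ≠ 0 := zpow_ne_zero n hp0
    rw [zpow_add_one₀ hp0, mul_comm, theta_mul_left hp0 hp1 hz]
    simp [hz]
  induction n using Int.induction_on with
  | zero => simpa using theta_one hp1
  | succ n ih => exact (step _).2 ih
  | pred n ih => exact (step _).1 (by simpa using ih)

lemma theta_eq_zero_iff {p : ℂ} (hp0 : p ≠ 0) (hp1 : ‖p‖ < 1) {z : ℂ} (hz : z ≠ 0) :
    theta p z = 0 ↔ ∃ n : ℤ, z = p ^ n := by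
  refine ⟨fun h => ?_, fun ⟨n, hn⟩ => hn ▸ theta_zpow hp0 hp1 n⟩
  by_contra! hn
  refine mul_ne_zero (pochInf_ne_zero hp1 fun k hk => ?_) (pochInf_ne_zero hp1 fun k hk => ?_) h
  · exact hn (-k) (by rw [zpow_neg, zpow_natCast]; exact eq_inv_of_mul_eq_one_right hk)
  · apply hn (k + 1)
    field_simp at hk
    rw [zpow_add_one₀ hp0, zpow_natCast]
    exact hk.symm

lemma deriv_theta_one_ne_zero {p : ℂ} (hp1 : ‖p‖ < 1) : deriv (theta p) 1 ≠ 0 := by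
  have hpoch : pochInf p p ≠ 0 := pochInf_ne_zero hp1 fun k hk => by
    have h1 : ‖p ^ k * p‖ < 1 := by
      rw [← pow_succ, norm_pow]
      exact pow_lt_one₀ (norm_nonneg p) hp1 (by simp)
    rw [hk] at h1
    simp at h1
  have h := differentiable_pochInf hp1
  have h1 : DifferentiableAt ℂ (fun z : ℂ => pochInf p (p * z) * pochInf p (p / z)) 1 :=
    ((h _).comp 1 (by fun_prop)).mul
      ((h _).comp 1 ((differentiableAt_const p).div differentiableAt_id one_ne_zero))
  have h2 : HasDerivAt (fun z : ℂ => 1 - z) (-1) 1 := by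
    simpa using (hasDerivAt_id (1 : ℂ)).const_sub 1
  have h3 := h2.mul h1.hasDerivAt
  have h4 : theta p = (fun z : ℂ => 1 - z) * fun z : ℂ => pochInf p (p * z) * pochInf p (p / z) := by
    funext z; exact theta_eq_sub_mul hp1 z
  rw [h4, h3.deriv]
  simp [hpoch]

lemma deriv_theta_mul_left {p : ℂ} (hp0 : p ≠ 0) (hp1 : ‖p‖ < 1) {z : ℂ} (hz : z ≠ 0)
    (h : theta p z = 0) : p * deriv (theta p) (p * z) = -z⁻¹ * deriv (theta p) z := by
  have hd : ∀ w : ℂ, w ≠ 0 → HasDerivAt (theta p) (deriv (theta p) w) w := fun w hw =>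
    ((differentiableOn_theta hp1).differentiableAt (isOpen_compl_singleton.mem_nhds hw)).hasDerivAt
  have h1 : HasDerivAt (fun w => theta p (p * w)) (deriv (theta p) (p * z) * p) z :=
    (hd (p * z) (mul_ne_zero hp0 hz)).comp z (by simpa using (hasDerivAt_id z).const_mul p)
  have h2 := (hasDerivAt_inv hz).neg.mul (hd z hz)
  have h3 : (fun w => theta p (p * w)) =ᶠ[𝓝 z] ((-Inv.inv) * theta p) := by
    filter_upwards [isOpen_compl_singleton.mem_nhds hz] with w hw
    exact theta_mul_left hp0 hp1 hw
  have h4 := h1.unique (h2.congr_of_eventuallyEq h3)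
  rw [mul_comm, h4, h]
  simp

/-- All zeros are simple: the zero at 1 is, and differentiating the functional equation at a zero
carries this along `p^ℤ`. Simplicity is what makes division by `θ(z/a)` possible. -/
lemma deriv_theta_ne_zero {p : ℂ} (hp0 : p ≠ 0) (hp1 : ‖p‖ < 1) {z : ℂ} (hz : z ≠ 0)
    (h : theta p z = 0) : deriv (theta p) z ≠ 0 := by
  obtain ⟨n, rfl⟩ := (theta_eq_zero_iff hp0 hp1 hz).1 h
  have step : ∀ n : ℤ, deriv (theta p) (p ^ (n + 1)) = 0 ↔ deriv (theta p) (p ^ n) = 0 := fun n => by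
    have hz : p ^ n ≠ 0 := zpow_ne_zero n hp0
    have h := deriv_theta_mul_left hp0 hp1 hz (theta_zpow hp0 hp1 n)
    rw [zpow_add_one₀ hp0, mul_comm]
    constructor <;> intro h0 <;> rw [h0] at h <;> simpa [hp0, hz] using h
  clear h hz
  induction n using Int.induction_on with
  | zero => simpa using deriv_theta_one_ne_zero hp1
  | succ n ih => exact fun h => ih ((step _).1 h)
  | pred n ih => exact fun h => ih (by simpa using (step (-n - 1)).2 h)

/-! ### Theta functions of degree `n` on `ℂ*`: division, Liouville, and determination by zeros. -/

section

/-- `f` is holomorphic on `ℂ*` and satisfies `f(pz) = (-1)^n t z^{-n} f(z)`. -/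
def IsTheta (p : ℂ) (n : ℕ) (t : ℂ) (f : ℂ → ℂ) : Prop :=
  DifferentiableOn ℂ f {0}ᶜ ∧ ∀ z : ℂ, z ≠ 0 → f (p * z) = (-1) ^ n * t / z ^ n * f z

namespace IsTheta

variable {p t t' : ℂ} {n n' : ℕ} {f g : ℂ → ℂ}

lemma mul (hf : IsTheta p n t f) (hg : IsTheta p n' t' g) :
    IsTheta p (n + n') (t * t') (fun z => f z * g z) := by
  refine ⟨hf.1.mul hg.1, fun z hz => ?_⟩
  simp only [hf.2 z hz, hg.2 z hz]
  field_simp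
  ring

lemma const_mul (hf : IsTheta p n t f) (c : ℂ) : IsTheta p n t (fun z => c * f z) :=
  ⟨hf.1.const_mul c, fun z hz => by simp only [hf.2 z hz]; ring⟩

lemma mul_const (hf : IsTheta p n t f) (c : ℂ) : IsTheta p n t (fun z => f z * c) :=
  ⟨hf.1.mul_const c, fun z hz => by simp only [hf.2 z hz]; ring⟩

lemma sub (hf : IsTheta p n t f) (hg : IsTheta p n t g) : IsTheta p n t (fun z => f z - g z) :=
  ⟨hf.1.sub hg.1, fun z hz => by simp only [hf.2 z hz, hg.2 z hz]; ring⟩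

lemma add (hf : IsTheta p n t f) (hg : IsTheta p n t g) : IsTheta p n t (fun z => f z + g z) :=
  ⟨hf.1.add hg.1, fun z hz => by simp only [hf.2 z hz, hg.2 z hz]; ring⟩

lemma sum {ι : Type*} {s : Finset ι} {F : ι → ℂ → ℂ} (hF : ∀ i ∈ s, IsTheta p n t (F i)) :
    IsTheta p n t (fun z => ∑ i ∈ s, F i z) := by
  refine ⟨DifferentiableOn.fun_sum fun i hi => (hF i hi).1, fun z hz => ?_⟩
  rw [Finset.mul_sum]
  exact Finset.sum_congr rfl fun i hi => (hF i hi).2 z hz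

lemma one : IsTheta p 0 1 (fun _ => 1) := ⟨differentiableOn_const 1, fun z _ => by simp⟩

lemma prod {ι : Type*} {s : Finset ι} {F : ι → ℂ → ℂ} {T : ι → ℂ}
    (hF : ∀ i ∈ s, IsTheta p 1 (T i) (F i)) :
    IsTheta p s.card (∏ i ∈ s, T i) (fun z => ∏ i ∈ s, F i z) := by
  classical
  induction s using Finset.induction_on with
  | empty => simpa using one
  | insert a s ha ih =>
    simp only [Finset.prod_insert ha, Finset.card_insert_of_notMem ha]
    rw [add_comm]
    exact (hF a (by simp)).mul (ih fun i hi => hF i (by simp [hi]))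

lemma map_zpow_mul_eq_zero (hp0 : p ≠ 0) (ht : t ≠ 0) (hf : IsTheta p n t f) {a : ℂ} (ha : a ≠ 0)
    (h : f a = 0) (k : ℤ) : f (p ^ k * a) = 0 := by
  have step : ∀ k : ℤ, f (p ^ (k + 1) * a) = 0 ↔ f (p ^ k * a) = 0 := fun k => by
    have hz : p ^ k * a ≠ 0 := mul_ne_zero (zpow_ne_zero k hp0) ha
    rw [zpow_add_one₀ hp0, mul_comm (p ^ k) p, mul_assoc, hf.2 _ hz]
    simp [ht, hz]
  induction k using Int.induction_on with
  | zero => simpa using h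
  | succ n ih => exact (step _).2 ih
  | pred n ih => exact (step _).1 (by simpa using ih)

end IsTheta

variable {p : ℂ}

lemma isTheta_theta_mul (hp0 : p ≠ 0) (hp1 : ‖p‖ < 1) {c : ℂ} (hc : c ≠ 0) :
    IsTheta p 1 c⁻¹ (fun z => theta p (c * z)) := by
  refine ⟨(differentiableOn_theta hp1).comp (by fun_prop) fun z hz => ?_, fun z hz => ?_⟩
  · exact mul_ne_zero hc hz
  · simp only [mul_left_comm c p z, theta_mul_left hp0 hp1 (mul_ne_zero hc hz)]
    field_simp

lemma isTheta_theta_div (hp0 : p ≠ 0) (hp1 : ‖p‖ < 1) {a : ℂ} (ha : a ≠ 0) :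
    IsTheta p 1 a (fun z => theta p (z / a)) := by
  simpa [div_eq_inv_mul] using isTheta_theta_mul hp0 hp1 (inv_ne_zero ha)

lemma theta_div_eq_zero_iff (hp0 : p ≠ 0) (hp1 : ‖p‖ < 1) {z a : ℂ} (hz : z ≠ 0) (ha : a ≠ 0) :
    theta p (z / a) = 0 ↔ ∃ n : ℤ, z = p ^ n * a := by
  simp only [theta_eq_zero_iff hp0 hp1 (div_ne_zero hz ha), div_eq_iff ha]

lemma dense_prod_theta_ne_zero (hp0 : p ≠ 0) (hp1 : ‖p‖ < 1) {ι : Type*} [Finite ι] {a : ι → ℂ}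
    (ha : ∀ i, a i ≠ 0) : Dense {z : ℂ | z ≠ 0 ∧ ∀ i, theta p (z / a i) ≠ 0} := by
  have hc : ({0} ∪ ⋃ i, range fun n : ℤ => p ^ n * a i : Set ℂ).Countable :=
    (countable_singleton 0).union (countable_iUnion fun i => countable_range _)
  refine (hc.dense_compl ℂ).mono fun z hz => ?_
  simp only [mem_compl_iff, mem_union, mem_singleton_iff, mem_iUnion, mem_range, not_or,
    not_exists] at hz
  refine ⟨hz.1, fun i h => ?_⟩
  obtain ⟨n, hn⟩ := (theta_div_eq_zero_iff hp0 hp1 hz.1 (ha i)).1 h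
  exact hz.2 i n hn.symm

/-- Two continuous functions on `ℂ*` agree if they agree off the zeros of finitely many thetas. -/
lemma eq_of_eq_of_theta_ne_zero (hp0 : p ≠ 0) (hp1 : ‖p‖ < 1) {ι : Type*} [Finite ι] {a : ι → ℂ}
    (ha : ∀ i, a i ≠ 0) {f g : ℂ → ℂ} (hf : DifferentiableOn ℂ f {0}ᶜ)
    (hg : DifferentiableOn ℂ g {0}ᶜ)
    (h : ∀ z, z ≠ 0 → (∀ i, theta p (z / a i) ≠ 0) → f z = g z) {z : ℂ} (hz : z ≠ 0) :
    f z = g z := by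
  have hd := dense_prod_theta_ne_zero hp0 hp1 ha
  exact EqOn.of_subset_closure (s := {z : ℂ | z ≠ 0 ∧ ∀ i, theta p (z / a i) ≠ 0})
    (fun w hw => h w hw.1 hw.2) hf.continuousOn hg.continuousOn (fun w hw => hw.1)
    (by rw [hd.closure_eq]; exact subset_univ _) hz

/-- A function vanishing at the simple zeros of `h` is divisible by `h`. -/
lemma exists_differentiableOn_eq_mul {f h : ℂ → ℂ} {U : Set ℂ} (hU : IsOpen U)
    (hf : DifferentiableOn ℂ f U) (hh : DifferentiableOn ℂ h U)
    (hfh : ∀ z ∈ U, h z = 0 → f z = 0 ∧ deriv h z ≠ 0) :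
    ∃ g, DifferentiableOn ℂ g U ∧ ∀ z ∈ U, f z = h z * g z := by
  classical
  -- The quotient, with its removable singularities filled by l'Hôpital's rule.
  refine ⟨fun z => if h z = 0 then deriv f z / deriv h z else f z / h z, fun z hz => ?_,
    fun z hz => ?_⟩
  · apply DifferentiableAt.differentiableWithinAt
    have hUz := hU.mem_nhds hz
    have hfz := hf.differentiableAt hUz
    have hhz := hh.differentiableAt hUz
    by_cases h0 : h z = 0
    · obtain ⟨f0, hd⟩ := hfh z hz h0
      have df := ((Complex.differentiableOn_dslope hUz).2 hf).differentiableAt hUz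
      have dh := ((Complex.differentiableOn_dslope hUz).2 hh).differentiableAt hUz
      have hne : dslope h z z ≠ 0 := by rwa [dslope_same]
      -- Near a zero `z` of `h`, the quotient coincides with the quotient of the two difference
      -- slopes based at `z`, both holomorphic, the lower one nonzero at `z`.
      refine (df.div dh hne).congr_of_eventuallyEq ?_
      filter_upwards [dh.continuousAt.eventually_ne hne] with w hw
      by_cases hwz : w = z
      · subst hwz
        simp [h0]
      · have hs : h w ≠ 0 := fun h1 => hw (by simp [dslope_of_ne _ hwz, slope, h0, h1])
        have hwz' : w - z ≠ 0 := sub_ne_zero.2 hwz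
        simp only [if_neg hs, Pi.div_apply, dslope_of_ne _ hwz, slope, h0, f0, vsub_eq_sub,
          sub_zero, smul_eq_mul]
        field_simp
    · refine (hfz.div hhz h0).congr_of_eventuallyEq ?_
      filter_upwards [hhz.continuousAt.eventually_ne h0] with w hw
      simp [hw]
  · by_cases h0 : h z = 0
    · simp [h0, (hfh z hz h0).1]
    · simp only [if_neg h0]
      field_simp

/-- The zero at `a` propagates to all of `p^ℤ a`, which is exactly the zero set of `θ(z/a)`, and
those zeros are simple. The multiplier of the quotient follows by cancellation off this set and then
by density. -/
lemma IsTheta.exists_eq_theta_mul (hp0 : p ≠ 0) (hp1 : ‖p‖ < 1) {n : ℕ} {t a : ℂ} {f : ℂ → ℂ}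
    (ht : t ≠ 0) (ha : a ≠ 0) (hf : IsTheta p (n + 1) t f) (h : f a = 0) :
    ∃ g, IsTheta p n (t / a) g ∧ ∀ z, z ≠ 0 → f z = theta p (z / a) * g z := by
  have hΘ := isTheta_theta_div hp0 hp1 ha
  obtain ⟨g, hg, hfg⟩ := exists_differentiableOn_eq_mul isOpen_compl_singleton hf.1 hΘ.1
    fun z (hz : z ≠ 0) h0 => by
      constructor
      · obtain ⟨k, rfl⟩ := (theta_div_eq_zero_iff hp0 hp1 hz ha).1 h0
        exact hf.map_zpow_mul_eq_zero hp0 ht ha h k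
      · have hza := div_ne_zero hz ha
        have hd : HasDerivAt (theta p) (deriv (theta p) (z / a)) (z / a) :=
          ((differentiableOn_theta hp1).differentiableAt
            (isOpen_compl_singleton.mem_nhds hza)).hasDerivAt
        have hc := hd.comp z ((hasDerivAt_id z).div_const a)
        rw [show (fun z => theta p (z / a)) = theta p ∘ fun z => id z / a from rfl, hc.deriv]
        exact mul_ne_zero (deriv_theta_ne_zero hp0 hp1 hza h0) (by simpa using ha)
  refine ⟨g, ⟨hg, fun z hz => ?_⟩, hfg⟩
  have hmaps : MapsTo (fun z => p * z) ({0}ᶜ : Set ℂ) {0}ᶜ := fun w hw => mul_ne_zero hp0 hw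
  refine eq_of_eq_of_theta_ne_zero hp0 hp1 (a := fun _ : Unit => a) (fun _ => ha)
    (f := fun z => g (p * z)) (g := fun z => (-1) ^ n * (t / a) / z ^ n * g z)
    (hg.comp (by fun_prop) hmaps) ?_ (fun z hz h0 => ?_) hz
  · refine DifferentiableOn.mul (DifferentiableOn.div (by fun_prop) (by fun_prop) ?_) hg
    exact fun w hw => pow_ne_zero n hw
  · have h0 := h0 ()
    have e := hf.2 z hz
    have e' : theta p (p * z / a) = _ := hΘ.2 z hz
    rw [hfg _ hz, hfg _ (mul_ne_zero hp0 hz), e'] at e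
    have hpow := pow_ne_zero n hz
    field_simp at e ⊢
    rw [pow_succ, pow_succ] at e
    have hm : ((-1 : ℂ) ^ n) ≠ 0 := by simp
    apply mul_left_cancel₀ hz
    linear_combination -e

/-- Liouville's theorem on `ℂ* / p^ℤ`. -/
lemma IsTheta.eq_const (hp0 : p ≠ 0) (hp1 : ‖p‖ < 1) {t : ℂ} {f : ℂ → ℂ} (ht : ‖t‖ = 1)
    (hf : IsTheta p 0 t f) : ∃ c, ∀ z, z ≠ 0 → f z = c := by
  have hper : ∀ z, z ≠ 0 → ‖f (p * z)‖ = ‖f z‖ := fun z hz => by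
    rw [hf.2 z hz]; simp [ht]
  have hperz : ∀ (k : ℤ) (z : ℂ), z ≠ 0 → ‖f (p ^ k * z)‖ = ‖f z‖ := fun k z hz => by
    have step : ∀ k : ℤ, ‖f (p ^ (k + 1) * z)‖ = ‖f (p ^ k * z)‖ := fun k => by
      rw [zpow_add_one₀ hp0, mul_comm (p ^ k) p, mul_assoc,
        hper _ (mul_ne_zero (zpow_ne_zero k hp0) hz)]
    induction k using Int.induction_on with
    | zero => simp
    | succ n ih => rw [step, ih]
    | pred n ih => rw [← ih, ← step, sub_add_cancel]
  have hpn : 0 < ‖p‖ := norm_pos_iff.2 hp0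
  -- This closed annulus meets every `p^ℤ`-orbit, and `‖f‖` is constant on orbits, so a bound here
  -- is global.
  have hcomp : IsCompact (Metric.closedBall (0 : ℂ) ‖p‖⁻¹ ∩ {z | 1 ≤ ‖z‖}) :=
    (isCompact_closedBall 0 _).inter_right (isClosed_le continuous_const continuous_norm)
  obtain ⟨C, hC⟩ := hcomp.exists_bound_of_continuousOn (f := f)
    (hf.1.continuousOn.mono fun z hz h0 => by
      have : (1 : ℝ) ≤ ‖z‖ := hz.2
      rw [mem_singleton_iff.1 h0, norm_zero] at this
      linarith)
  have hbd : ∀ z, z ≠ 0 → ‖f z‖ ≤ C := fun z hz => by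
    obtain ⟨k, hk1, hk2⟩ := exists_mem_Ico_zpow (norm_pos_iff.2 hz) ((one_lt_inv₀ hpn).2 hp1)
    rw [← hperz k z hz]
    have hpk : 0 < ‖p‖ ^ k := zpow_pos hpn k
    refine hC _ ⟨?_, ?_⟩
    · rw [mem_closedBall_zero_iff, norm_mul, norm_zpow]
      calc ‖p‖ ^ k * ‖z‖ ≤ ‖p‖ ^ k * (‖p‖⁻¹ ^ (k + 1)) := by gcongr
        _ = ‖p‖⁻¹ := by
          rw [zpow_add_one₀ (inv_ne_zero hpn.ne'), inv_zpow]
          field_simp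
    · change 1 ≤ ‖p ^ k * z‖
      rw [norm_mul, norm_zpow]
      calc (1 : ℝ) = ‖p‖ ^ k * (‖p‖⁻¹ ^ k) := by
            rw [inv_zpow]; field_simp
        _ ≤ ‖p‖ ^ k * ‖z‖ := by gcongr
  -- Composition with `exp` gives a bounded entire function.
  have hdiff : Differentiable ℂ fun w => f (Complex.exp w) := fun w =>
    (hf.1.differentiableAt (isOpen_compl_singleton.mem_nhds (Complex.exp_ne_zero w))).comp w
      Complex.differentiableAt_exp
  have hb : Bornology.IsBounded (range fun w => f (Complex.exp w)) := by
    refine isBounded_iff_forall_norm_le.2 ⟨C, ?_⟩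
    rintro _ ⟨w, rfl⟩
    exact hbd _ (Complex.exp_ne_zero w)
  refine ⟨f (Complex.exp 0), fun z hz => ?_⟩
  rw [← Complex.exp_log hz]
  exact hdiff.apply_eq_apply_of_bounded hb _ _

/-- Subtract the multiple of `θ(z/a)` that agrees with `f` at `-a`, which is legitimate since `θ(-1)
≠ 0`. Dividing by `θ(-z/a)` leaves degree 0 with parameter `-1`: a constant equal to its own
negative. This is why Liouville is stated for `‖t‖ = 1` and not only for `t = 1`. -/
lemma IsTheta.eq_theta_of_one (hp0 : p ≠ 0) (hp1 : ‖p‖ < 1) {a : ℂ} {f : ℂ → ℂ} (ha : a ≠ 0)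
    (hf : IsTheta p 1 a f) : ∃ c, ∀ z, z ≠ 0 → f z = c * theta p (z / a) := by
  have hneg : (-1 : ℂ) ≠ 1 := by norm_num
  have h1 : theta p (-a / a) ≠ 0 := by
    rw [neg_div, div_self ha]
    intro h
    obtain ⟨n, hn⟩ := (theta_eq_zero_iff hp0 hp1 (by norm_num)).1 h
    have h2 : ‖p‖ ^ n = 1 := by rw [← norm_zpow, ← hn]; simp
    have hpn : 0 < ‖p‖ := norm_pos_iff.2 hp0
    rcases (zpow_eq_one_iff_right₀ hpn.le hp1.ne).1 h2 with rfl
    simp at hn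
    exact hneg hn
  set c := f (-a) / theta p (-a / a) with hc
  have hg := hf.sub ((isTheta_theta_div hp0 hp1 ha).const_mul c)
  obtain ⟨g, hg, hfg⟩ := IsTheta.exists_eq_theta_mul (n := 0) hp0 hp1 ha (neg_ne_zero.2 ha) hg
    (by rw [hc, div_mul_cancel₀ _ h1, sub_self])
  rw [div_neg, div_self ha] at hg
  obtain ⟨d, hd⟩ := hg.eq_const hp0 hp1 (by simp)
  have h2 := hg.2 1 one_ne_zero
  rw [mul_one, hd p hp0, hd 1 one_ne_zero] at h2
  have hd0 : d = 0 := by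
    simp at h2
    linear_combination h2 / 2
  refine ⟨c, fun z hz => ?_⟩
  have := hfg z hz
  rw [hd z hz, hd0, mul_zero] at this
  exact sub_eq_zero.1 this

lemma IsTheta.exists_eq_prod_mul (hp0 : p ≠ 0) (hp1 : ‖p‖ < 1) {ι : Type*} {a : ι → ℂ}
    (ha : ∀ i, a i ≠ 0) (hinj : ∀ i j, i ≠ j → ∀ n : ℤ, a i ≠ p ^ n * a j) {n : ℕ} {t : ℂ}
    (ht : t ≠ 0) (s : Finset ι) {f : ℂ → ℂ} (hf : IsTheta p (n + s.card) t f)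
    (h : ∀ i ∈ s, f (a i) = 0) :
    ∃ g, IsTheta p n (t / ∏ i ∈ s, a i) g ∧
      ∀ z, z ≠ 0 → f z = (∏ i ∈ s, theta p (z / a i)) * g z := by
  classical
  induction s using Finset.induction_on generalizing f t with
  | empty => exact ⟨f, by simpa using hf, by simp⟩
  | insert b s hb ih =>
    rw [Finset.card_insert_of_notMem hb, ← add_assoc] at hf
    obtain ⟨f', hf', hff'⟩ := hf.exists_eq_theta_mul hp0 hp1 ht (ha b) (h b (by simp))
    obtain ⟨g, hg, hfg⟩ := ih (div_ne_zero ht (ha b)) hf' fun i hi => by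
      have h1 := h i (by simp [hi])
      rw [hff' _ (ha i)] at h1
      refine (mul_eq_zero.1 h1).resolve_left fun h2 => ?_
      obtain ⟨k, hk⟩ := (theta_div_eq_zero_iff hp0 hp1 (ha i) (ha b)).1 h2
      exact hinj i b (fun e => hb (e ▸ hi)) k hk
    refine ⟨g, ?_, fun z hz => ?_⟩
    · rwa [Finset.prod_insert hb, ← div_div]
    · rw [hff' z hz, hfg z hz, Finset.prod_insert hb, mul_assoc]

/-- A theta function vanishing at all but one of its prescribed zeros is determined up to scaling. -/
lemma IsTheta.eq_const_mul_prod (hp0 : p ≠ 0) (hp1 : ‖p‖ < 1) {ι : Type*} [Fintype ι] {a : ι → ℂ}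
    (ha : ∀ i, a i ≠ 0) (hinj : ∀ i j, i ≠ j → ∀ n : ℤ, a i ≠ p ^ n * a j) {f : ℂ → ℂ}
    (hf : IsTheta p (Fintype.card ι) (∏ i, a i) f) (i₀ : ι) (h : ∀ i, i ≠ i₀ → f (a i) = 0) :
    ∃ c, ∀ z, z ≠ 0 → f z = c * ∏ i, theta p (z / a i) := by
  classical
  have hcard : Fintype.card ι = 1 + (Finset.univ.erase i₀).card := by
    rw [Finset.card_erase_of_mem (Finset.mem_univ _), Finset.card_univ]
    have := Fintype.card_pos_iff.2 ⟨i₀⟩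
    omega
  rw [hcard] at hf
  obtain ⟨g, hg, hfg⟩ := hf.exists_eq_prod_mul hp0 hp1 ha hinj
    (Finset.prod_ne_zero_iff.2 fun i _ => ha i) _ (fun i hi => h i (Finset.ne_of_mem_erase hi))
  -- After removing all but one zero, the remaining parameter is `a i₀`, which forces the last zero.
  have hpr : (∏ i, a i) / ∏ i ∈ Finset.univ.erase i₀, a i = a i₀ := by
    rw [← Finset.mul_prod_erase _ _ (Finset.mem_univ i₀)]
    exact mul_div_cancel_right₀ _ (Finset.prod_ne_zero_iff.2 fun i _ => ha i)
  rw [hpr] at hg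
  obtain ⟨c, hc⟩ := hg.eq_theta_of_one hp0 hp1 (ha i₀)
  refine ⟨c, fun z hz => ?_⟩
  rw [hfg z hz, hc z hz, ← Finset.mul_prod_erase _ _ (Finset.mem_univ i₀)]
  ring

end

/-! ### Linear algebra of singular `2 × 2` matrices. -/

lemma exists_of_range_eq_span {A : Matrix (Fin 2) (Fin 2) ℂ} {a b : ℂ}
    (h : LinearMap.range A.mulVecLin = Submodule.span ℂ {![a, b]}) (j : Fin 2) :
    ∃ c, A 0 j = c * a ∧ A 1 j = c * b := by
  have hm : A.mulVecLin (Pi.single j 1) ∈ Submodule.span ℂ {![a, b]} := h ▸ LinearMap.mem_range_self _ _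
  obtain ⟨c, hc⟩ := Submodule.mem_span_singleton.1 hm
  have h0 := congrFun hc 0
  have h1 := congrFun hc 1
  simp at h0 h1
  exact ⟨c, h0.symm, h1.symm⟩

lemma range_eq_span_of_forall {A : Matrix (Fin 2) (Fin 2) ℂ} {a b : ℂ} (hA : A ≠ 0)
    (c : Fin 2 → ℂ) (h : ∀ j, A 0 j = c j * a ∧ A 1 j = c j * b) :
    LinearMap.range A.mulVecLin = Submodule.span ℂ {![a, b]} := by
  apply le_antisymm
  · rintro _ ⟨w, rfl⟩
    refine Submodule.mem_span_singleton.2 ⟨c 0 * w 0 + c 1 * w 1, ?_⟩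
    ext i
    fin_cases i <;> simp [Matrix.mulVec, dotProduct, h] <;> ring
  · rw [Submodule.span_singleton_le_iff_mem]
    have hc : ∃ j, c j ≠ 0 := by
      by_contra! hc
      apply hA
      ext i j
      fin_cases i <;> simp [h, hc]
    obtain ⟨j, hj⟩ := hc
    refine ⟨Pi.single j (c j)⁻¹, ?_⟩
    ext i
    fin_cases i <;> simp [h] <;> field_simp

lemma ker_eq_span_of_mulVec {A : Matrix (Fin 2) (Fin 2) ℂ} {v : Fin 2 → ℂ} (hA : A ≠ 0)
    (hv : v ≠ 0) (h : A.mulVec v = 0) :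
    LinearMap.ker A.mulVecLin = Submodule.span ℂ {v} := by
  apply le_antisymm
  · intro w hw
    have hw : A.mulVec w = 0 := hw
    obtain ⟨i, hi⟩ : ∃ i, A i 0 ≠ 0 ∨ A i 1 ≠ 0 := by
      by_contra! hc
      apply hA
      ext i j
      fin_cases j <;> simp [hc i]
    have h1 := congrFun h i
    have h2 := congrFun hw i
    simp only [Matrix.mulVec, dotProduct, Fin.sum_univ_two, Pi.zero_apply] at h1 h2
    have h3 : v 0 * w 1 = v 1 * w 0 := by
      rcases hi with hi | hi <;> apply mul_left_cancel₀ hi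
      · linear_combination w 1 * h1 - v 1 * h2
      · linear_combination v 0 * h2 - w 0 * h1
    have hv' : v 0 ≠ 0 ∨ v 1 ≠ 0 := by
      by_contra! hc
      apply hv
      ext j
      fin_cases j <;> simp [hc]
    rcases hv' with hv' | hv'
    · refine Submodule.mem_span_singleton.2 ⟨w 0 / v 0, ?_⟩
      ext j
      fin_cases j
      · simp [hv']
      · simp only [Fin.mk_one, Pi.smul_apply, smul_eq_mul]
        field_simp
        linear_combination -h3
    · refine Submodule.mem_span_singleton.2 ⟨w 1 / v 1, ?_⟩
      ext j
      fin_cases j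
      · simp only [Fin.zero_eta, Pi.smul_apply, smul_eq_mul]
        field_simp
        linear_combination h3
      · simp [hv']
  · rw [Submodule.span_singleton_le_iff_mem]
    exact h

/-- For singular `A` the columns of `adj A` lie in `ker A`, hence in `ker B`. -/
lemma mul_adjugate_eq_zero_of_ker_eq {A B : Matrix (Fin 2) (Fin 2) ℂ}
    (h : LinearMap.ker A.mulVecLin = LinearMap.ker B.mulVecLin) (hA : A.det = 0) :
    B * A.adjugate = 0 := by
  have hA' : A * A.adjugate = 0 := by rw [Matrix.mul_adjugate, hA, zero_smul]
  ext i j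
  have hm : A.adjugate.col j ∈ LinearMap.ker A.mulVecLin := by
    funext k
    exact congrFun (congrFun hA' k) j
  rw [h] at hm
  exact congrFun (show B.mulVec (A.adjugate.col j) = 0 from hm) i

lemma eq_emb_or {m : ℕ} (k : Fin (2 * m + 6)) :
    (∃ i, k = emb m i) ∨ k = i3 m ∨ k = i4 m ∨ k = i5 m := by
  by_cases h : (k : ℕ) < 2 * m + 3
  · exact Or.inl ⟨⟨k, h⟩, rfl⟩
  · simp only [i3, i4, i5, Fin.ext_iff]
    omega

/-! ### Uniqueness up to a scalar. -/

section

variable {p : ℂ} {m : ℕ} {u : Fin (2 * m + 6) → ℂ} {L : ℂ}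

lemma IsThetaMatrix.isTheta {M : ℂ → Matrix (Fin 2) (Fin 2) ℂ} (hM : IsThetaMatrix p m L M)
    (i j : Fin 2) : IsTheta p (m + 3) L (fun z => M z i j) := hM i j

lemma isTheta_mul_sub_mul (hL : L ^ 2 = ∏ j, u j) {f g h k : ℂ → ℂ}
    (hf : IsTheta p (m + 3) L f) (hg : IsTheta p (m + 3) L g) (hh : IsTheta p (m + 3) L h)
    (hk : IsTheta p (m + 3) L k) :
    IsTheta p (Fintype.card (Fin (2 * m + 6))) (∏ j, u j) (fun z => f z * g z - h z * k z) := by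
  have := (hf.mul hg).sub (hh.mul hk)
  rwa [← hL, Fintype.card_fin, sq, show 2 * m + 6 = m + 3 + (m + 3) by ring]

lemma IsThetaMatrix.det {M : ℂ → Matrix (Fin 2) (Fin 2) ℂ} (hM : IsThetaMatrix p m L M)
    (hL : L ^ 2 = ∏ j, u j) :
    IsTheta p (Fintype.card (Fin (2 * m + 6))) (∏ j, u j) (fun z => (M z).det) := by
  simp only [Matrix.det_fin_two]
  exact isTheta_mul_sub_mul hL (hM.isTheta _ _) (hM.isTheta _ _) (hM.isTheta _ _) (hM.isTheta _ _)

lemma prod_theta_eq_zero_iff (hp0 : p ≠ 0) (hp1 : ‖p‖ < 1) (hu0 : ∀ i, u i ≠ 0) {z : ℂ}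
    (hz : z ≠ 0) : ∏ j, theta p (z / u j) = 0 ↔ ∃ k, ∃ n : ℤ, z = p ^ n * u k := by
  simp [Finset.prod_eq_zero_iff, theta_div_eq_zero_iff hp0 hp1 hz (hu0 _)]

variable (hp0 : p ≠ 0) (hp1 : ‖p‖ < 1) (hu0 : ∀ i, u i ≠ 0)
  (hu : ∀ i j, i ≠ j → ∀ n : ℤ, u i ≠ p ^ n * u j) (hL : L ^ 2 = ∏ j, u j)
include hp0 hp1 hu0 hu hL

lemma IsThetaMatrix.exists_det_eq {M : ℂ → Matrix (Fin 2) (Fin 2) ℂ} (hM : IsThetaMatrix p m L M)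
    (h : ∀ k, (M (u k)).det = 0) :
    ∃ C, ∀ z, z ≠ 0 → (M z).det = C * ∏ j, theta p (z / u j) :=
  (hM.det hL).eq_const_mul_prod hp0 hp1 hu0 hu (i3 m) fun k _ => h k

/-- If all entries vanished at `u_k`, each would be divisible by `θ(z/u_k)` and the determinant
would have a double zero there, whereas `C ∏ θ(z/u_j)` with `C ≠ 0` has a simple one. -/
lemma IsThetaMatrix.ne_zero_of_propA1 {M : ℂ → Matrix (Fin 2) (Fin 2) ℂ}
    (hM : IsThetaMatrix p m L M) (h : PropA1 u M) (k : Fin (2 * m + 6)) : M (u k) ≠ 0 := by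
  intro h0
  obtain ⟨C, hC⟩ := hM.exists_det_eq hp0 hp1 hu0 hu hL h.1
  obtain ⟨z₀, hz₀, hd⟩ := h.2
  have hC0 : C ≠ 0 := by rintro rfl; exact hd (by rw [hC z₀ hz₀, zero_mul])
  have hL0 : L ≠ 0 := fun h => by
    rw [h, zero_pow two_ne_zero] at hL
    exact Finset.prod_ne_zero_iff.2 (fun i _ => hu0 i) hL.symm
  have hdiv : ∀ i j, ∃ g, IsTheta p (m + 2) (L / u k) g ∧
      ∀ z, z ≠ 0 → M z i j = theta p (z / u k) * g z := fun i j =>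
    (hM.isTheta i j).exists_eq_theta_mul hp0 hp1 hL0 (hu0 k) (by rw [h0]; rfl)
  choose g hg hMg using hdiv
  have hΘ := fun j => isTheta_theta_div hp0 hp1 (hu0 j)
  have key := eq_of_eq_of_theta_ne_zero hp0 hp1 hu0
    (f := fun z => theta p (z / u k) * (g 0 0 z * g 1 1 z - g 0 1 z * g 1 0 z))
    (g := fun z => C * ∏ j ∈ Finset.univ.erase k, theta p (z / u j))
    ((hΘ k).1.mul (((hg 0 0).1.mul (hg 1 1).1).sub ((hg 0 1).1.mul (hg 1 0).1)))
    ((IsTheta.prod fun i _ => hΘ i).1.const_mul C) (fun z hz hne => by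
      apply mul_left_cancel₀ (hne k)
      have := hC z hz
      rw [Matrix.det_fin_two, hMg _ _ z hz, hMg _ _ z hz, hMg _ _ z hz, hMg _ _ z hz,
        ← Finset.mul_prod_erase _ _ (Finset.mem_univ k)] at this
      linear_combination this) (hu0 k)
  rw [div_self (hu0 k), theta_one hp1, zero_mul] at key
  refine mul_ne_zero hC0 (Finset.prod_ne_zero_iff.2 fun j hj h1 => ?_) key.symm
  obtain ⟨n, hn⟩ := (theta_div_eq_zero_iff hp0 hp1 (hu0 k) (hu0 j)).1 h1
  exact hu k j (Finset.ne_of_mem_erase hj).symm n hn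

theorem exists_eq_smul_of_props {x y : Fin (2 * m + 3) → ℂ} {M N : ℂ → Matrix (Fin 2) (Fin 2) ℂ}
    (hM : IsThetaMatrix p m L M) (hM1 : PropA1 u M) (hM2 : PropA2 u x y M) (hM3 : PropA3 u M)
    (hN : IsThetaMatrix p m L N) (hN1 : PropA1 u N) (hN2 : PropA2 u x y N) (hN3 : PropA3 u N) :
    ∃ c : ℂ, c ≠ 0 ∧ ∀ z : ℂ, z ≠ 0 → N z = c • M z := by
  obtain ⟨C, hC⟩ := hM.exists_det_eq hp0 hp1 hu0 hu hL hM1.1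
  have hC0 : C ≠ 0 := by
    obtain ⟨z₀, hz₀, hd⟩ := hM1.2
    rintro rfl
    exact hd (by rw [hC z₀ hz₀, zero_mul])
  -- the structure of the two matrices at the last three points
  have h3 : ∀ {A : ℂ → Matrix (Fin 2) (Fin 2) ℂ}, PropA3 u A →
      ∀ j, A (u (i3 m)) 0 j = A (u (i3 m)) 1 j := fun hA j => by
    obtain ⟨c, h0, h1⟩ := exists_of_range_eq_span hA.1 j
    rw [h0, h1]
  have h4 : ∀ {A : ℂ → Matrix (Fin 2) (Fin 2) ℂ}, PropA3 u A →
      ∀ j, A (u (i4 m)) 0 j = 0 := fun hA j => by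
    obtain ⟨c, h0, h1⟩ := exists_of_range_eq_span hA.2.1 j
    rw [h0, mul_zero]
  have h5 : ∀ {A : ℂ → Matrix (Fin 2) (Fin 2) ℂ}, PropA3 u A →
      ∀ j, A (u (i5 m)) 1 j = 0 := fun hA j => by
    obtain ⟨c, h0, h1⟩ := exists_of_range_eq_span hA.2.2 j
    rw [h1, mul_zero]
  -- the entries of `N * adj M` vanish at the first `2m+3` points
  have hE : ∀ k i, N (u (emb m k)) i 0 * M (u (emb m k)) 1 1
        - N (u (emb m k)) i 1 * M (u (emb m k)) 1 0 = 0 ∧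
      N (u (emb m k)) i 1 * M (u (emb m k)) 0 0 - N (u (emb m k)) i 0 * M (u (emb m k)) 0 1 = 0 := by
    intro k i
    have h := mul_adjugate_eq_zero_of_ker_eq ((hM2 k).trans (hN2 k).symm) (hM1.1 _)
    rw [Matrix.adjugate_fin_two] at h
    have e0 := congrFun (congrFun h i) 0
    have e1 := congrFun (congrFun h i) 1
    simp [Matrix.mul_apply, Fin.sum_univ_two] at e0 e1
    exact ⟨by linear_combination e0, by linear_combination e1⟩
  have hpole : ∀ (f g h k : ℂ → ℂ) (i₀ : Fin (2 * m + 6)), IsTheta p (m + 3) L f →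
      IsTheta p (m + 3) L g → IsTheta p (m + 3) L h → IsTheta p (m + 3) L k →
      (∀ i, i ≠ i₀ → f (u i) * g (u i) - h (u i) * k (u i) = 0) →
      ∃ c, ∀ z, z ≠ 0 → f z * g z - h z * k z = c * ∏ j, theta p (z / u j) :=
    fun f g h k i₀ hf hg hh hk h0 =>
      (isTheta_mul_sub_mul hL hf hg hh hk).eq_const_mul_prod hp0 hp1 hu0 hu i₀ h0
  have hP3 : ∏ j, theta p (u (i3 m) / u j) = 0 :=
    (prod_theta_eq_zero_iff hp0 hp1 hu0 (hu0 _)).2 ⟨i3 m, 0, by simp⟩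
  obtain ⟨a, ha⟩ := hpole _ _ _ _ (i3 m) (hN.isTheta 0 0) (hM.isTheta 1 1) (hN.isTheta 0 1)
    (hM.isTheta 1 0) fun i hi => by
      rcases eq_emb_or i with ⟨k, rfl⟩ | rfl | rfl | rfl
      · exact (hE k 0).1
      · exact absurd rfl hi
      · simp [h4 hN3]
      · simp [h5 hM3]
  obtain ⟨d, hd⟩ := hpole _ _ _ _ (i3 m) (hN.isTheta 1 1) (hM.isTheta 0 0) (hN.isTheta 1 0)
    (hM.isTheta 0 1) fun i hi => by
      rcases eq_emb_or i with ⟨k, rfl⟩ | rfl | rfl | rfl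
      · exact (hE k 1).2
      · exact absurd rfl hi
      · simp [h4 hM3]
      · simp [h5 hN3]
  -- The diagonal entry turns out to vanish at `u_{2m+3}` as well. Both matrices have equal rows
  -- there, so the off-diagonal entries of `N · adj M` equal it up to sign; this supplies the zero
  -- they still lack.
  have ha3 := ha _ (hu0 (i3 m))
  rw [hP3, mul_zero, h3 hN3, h3 hN3, ← h3 hM3, ← h3 hM3] at ha3
  obtain ⟨b, hb⟩ := hpole _ _ _ _ (i5 m) (hN.isTheta 0 1) (hM.isTheta 0 0) (hN.isTheta 0 0)
    (hM.isTheta 0 1) fun i hi => by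
      rcases eq_emb_or i with ⟨k, rfl⟩ | rfl | rfl | rfl
      · exact (hE k 0).2
      · rw [h3 hN3, h3 hN3]
        linear_combination -ha3
      · simp [h4 hN3]
      · exact absurd rfl hi
  obtain ⟨c, hc⟩ := hpole _ _ _ _ (i4 m) (hN.isTheta 1 0) (hM.isTheta 1 1) (hN.isTheta 1 1)
    (hM.isTheta 1 0) fun i hi => by
      rcases eq_emb_or i with ⟨k, rfl⟩ | rfl | rfl | rfl
      · exact (hE k 1).1
      · rw [← h3 hM3, ← h3 hM3]
        linear_combination ha3
      · exact absurd rfl hi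
      · simp [h5 hN3]
  -- hence `N = K M` for a constant matrix `K`
  have hrow : ∀ (i : Fin 2) (r s : ℂ),
      (∀ z, z ≠ 0 → N z i 0 * M z 1 1 - N z i 1 * M z 1 0 = r * ∏ j, theta p (z / u j)) →
      (∀ z, z ≠ 0 → N z i 1 * M z 0 0 - N z i 0 * M z 0 1 = s * ∏ j, theta p (z / u j)) →
      ∀ j z, z ≠ 0 → C * N z i j = r * M z 0 j + s * M z 1 j := by
    intro i r s hr hs j z hz
    refine eq_of_eq_of_theta_ne_zero hp0 hp1 hu0 (f := fun z => C * N z i j)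
      (g := fun z => r * M z 0 j + s * M z 1 j) ((hN.isTheta i j).const_mul C).1
      (((hM.isTheta 0 j).const_mul r).add ((hM.isTheta 1 j).const_mul s)).1 (fun z hz hne => ?_) hz
    have hP : ∏ j, theta p (z / u j) ≠ 0 := Finset.prod_ne_zero_iff.2 fun i _ => hne i
    have hdet := hC z hz
    rw [Matrix.det_fin_two] at hdet
    have hr := hr z hz
    have hs := hs z hz
    apply mul_left_cancel₀ hP
    fin_cases j <;> simp only [Fin.zero_eta, Fin.mk_one]
    · linear_combination M z 0 0 * hr + M z 1 0 * hs - N z i 0 * hdet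
    · linear_combination M z 0 1 * hr + M z 1 1 * hs - N z i 1 * hdet
  have hr0 := hrow 0 a b ha hb
  have hr1 := hrow 1 c d hc hd
  have hex : ∀ {A : Matrix (Fin 2) (Fin 2) ℂ}, A ≠ 0 → ∃ i j, A i j ≠ 0 := fun hA => by
    by_contra! h
    exact hA (by ext i j; exact h i j)
  have hne := hM.ne_zero_of_propA1 hp0 hp1 hu0 hu hL hM1
  -- At `u_{2m+4}` the first rows of `M` and `N` vanish, so the relation reads `0 = b · M 1 j`, and
  -- the second row of `M` is nonzero there.
  have hb0 : b = 0 := by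
    obtain ⟨i, j, hij⟩ := hex (hne (i4 m))
    fin_cases i
    · exact absurd (h4 hM3 j) hij
    · have := hr0 j _ (hu0 (i4 m))
      rw [h4 hN3, h4 hM3, mul_zero, mul_zero, zero_add] at this
      exact (mul_eq_zero.1 this.symm).resolve_right hij
  have hc0 : c = 0 := by
    obtain ⟨i, j, hij⟩ := hex (hne (i5 m))
    fin_cases i
    · have := hr1 j _ (hu0 (i5 m))
      rw [h5 hN3, h5 hM3, mul_zero, mul_zero, add_zero] at this
      exact (mul_eq_zero.1 this.symm).resolve_right hij
    · exact absurd (h5 hM3 j) hij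
  subst hb0 hc0
  have had : a = d := by
    obtain ⟨i, j, hij⟩ := hex (hne (i3 m))
    have e0 := hr0 j _ (hu0 (i3 m))
    have e1 := hr1 j _ (hu0 (i3 m))
    have hij0 : M (u (i3 m)) 0 j ≠ 0 := by
      fin_cases i
      · exact hij
      · rw [h3 hM3]; exact hij
    rw [← h3 hN3, ← h3 hM3] at e1
    apply mul_right_cancel₀ hij0
    linear_combination e1 - e0
  subst had
  have hNM : ∀ z, z ≠ 0 → N z = (a / C) • M z := fun z hz => by
    ext i j
    rw [Matrix.smul_apply, smul_eq_mul]
    field_simp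
    fin_cases i
    · simpa [mul_comm C] using hr0 j z hz
    · simpa [mul_comm C] using hr1 j z hz
  refine ⟨a / C, fun h => ?_, hNM⟩
  obtain ⟨z, hz, hdz⟩ := hN1.2
  rw [hNM z hz, h, zero_smul] at hdz
  exact hdz (by simp)

end

/-! ### Passage to `A(z)`. -/

lemma matA_eq_of_eq_smul {M N : ℂ → Matrix (Fin 2) (Fin 2) ℂ} {c : ℂ} (hc : c ≠ 0)
    (h : ∀ z, z ≠ 0 → N z = c • M z) {q η z : ℂ} (hq : q ≠ 0) (hη : η ≠ 0) (hz : z ≠ 0) :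
    matA q η N z = matA q η M z := by
  rw [matA, matA, h z hz, h _ (div_ne_zero hη (mul_ne_zero hq hz))]
  set A := M (η / (q * z))
  by_cases hA : IsUnit A.det
  · have : Invertible c := invertibleOfNonzero hc
    rw [Matrix.inv_smul _ c hA, smul_mul_smul_comm, invOf_mul_self, one_smul]
  -- At singular points the inverse is by convention 0, on both sides.
  · have hA' : ¬ IsUnit (c • A).det := by
      rw [Matrix.det_smul]
      simpa [isUnit_iff_ne_zero, hc] using hA
    rw [Matrix.nonsing_inv_apply_not_isUnit _ hA, Matrix.nonsing_inv_apply_not_isUnit _ hA']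
    simp

/-! ### The explicit matrix `B(z)`: multipliers, kernels, images, determinant. -/

section

variable {p : ℂ} {m : ℕ} {u : Fin (2 * m + 6) → ℂ} {L : ℂ}

lemma uProd_ne_zero (hu0 : ∀ i, u i ≠ 0) (S : Finset (Fin (2 * m + 3))) : uProd u S ≠ 0 :=
  Finset.prod_ne_zero_iff.2 fun _ _ => hu0 _

lemma uProd_insert {S : Finset (Fin (2 * m + 3))} {k : Fin (2 * m + 3)} (hk : k ∉ S) :
    uProd u (insert k S) = u (emb m k) * uProd u S := by
  rw [uProd, Finset.prod_insert hk, uProd]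

lemma emb_injective (m : ℕ) : Function.Injective (emb m) := Fin.castLE_injective (by omega)

lemma prod_univ_eq (u : Fin (2 * m + 6) → ℂ) (S : Finset (Fin (2 * m + 3))) :
    ∏ j, u j = uProd u S * uProd u Sᶜ * u (i3 m) * u (i4 m) * u (i5 m) := by
  rw [uProd, uProd, Finset.prod_mul_prod_compl]
  rw [Fin.prod_univ_castSucc, Fin.prod_univ_castSucc, Fin.prod_univ_castSucc]
  rfl

lemma theta_div_ne_zero (hp0 : p ≠ 0) (hp1 : ‖p‖ < 1) (hu0 : ∀ i, u i ≠ 0)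
    (hu : ∀ i j, i ≠ j → ∀ n : ℤ, u i ≠ p ^ n * u j) {i j : Fin (2 * m + 6)} (hij : i ≠ j) :
    theta p (u i / u j) ≠ 0 := fun h => by
  obtain ⟨n, hn⟩ := (theta_div_eq_zero_iff hp0 hp1 (hu0 i) (hu0 j)).1 h
  exact hu i j hij n hn

lemma ne_zero_of_sq_eq_prod (hu0 : ∀ i, u i ≠ 0) (hL : L ^ 2 = ∏ j, u j) : L ≠ 0 := fun h => by
  rw [h, zero_pow two_ne_zero] at hL
  exact Finset.prod_ne_zero_iff.2 (fun i _ => hu0 i) hL.symm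

lemma isTheta_firstCol (hp0 : p ≠ 0) (hp1 : ‖p‖ < 1) (hu0 : ∀ i, u i ≠ 0) (hL0 : L ≠ 0)
    (x y : Fin (2 * m + 3) → ℂ) {w : ℂ} (hw : w ≠ 0) :
    IsTheta p (m + 3) L (firstCol p u L x y w) := by
  have hterm : ∀ S ∈ Finset.powersetCard (m + 1) (Finset.univ : Finset (Fin (2 * m + 3))),
      IsTheta p (m + 2) (L / w) fun z =>
        (∏ i ∈ S, x i) * (∏ i ∈ Sᶜ, y i) / (uProd u Sᶜ * w) *
        (theta p (uProd u S * w * z / L) * theta p (uProd u Sᶜ * w / L)) *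
        (∏ i ∈ S, theta p (z / u (emb m i))) * weight p u S := fun S hS => by
    have hc : uProd u S * w / L ≠ 0 := div_ne_zero (mul_ne_zero (uProd_ne_zero hu0 S) hw) hL0
    have h1 := isTheta_theta_mul hp0 hp1 hc
    have h2 : IsTheta p S.card (uProd u S) fun z => ∏ i ∈ S, theta p (z / u (emb m i)) :=
      IsTheta.prod fun i _ => isTheta_theta_div hp0 hp1 (hu0 _)
    have h3 := ((((h1.mul_const (theta p (uProd u Sᶜ * w / L))).const_mul
      ((∏ i ∈ S, x i) * (∏ i ∈ Sᶜ, y i) / (uProd u Sᶜ * w))).mul h2).mul_const (weight p u S))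
    rw [(Finset.mem_powersetCard.1 hS).2] at h3
    -- The dependence on `S` cancels, so all summands share one multiplier; the prefactor `θ(z/w)`
    -- then contributes the missing `w`.
    have e : (uProd u S * w / L)⁻¹ * uProd u S = L / w := by
      have := uProd_ne_zero hu0 S
      field_simp
    rw [e, show 1 + (m + 1) = m + 2 by ring] at h3
    simpa only [mul_div_right_comm] using h3
  have h := ((isTheta_theta_div hp0 hp1 hw).mul_const (theta p (u (i3 m) / w))⁻¹).mul
    (IsTheta.sum hterm)
  rwa [mul_div_cancel₀ _ hw, show 1 + (m + 2) = m + 3 by ring] at h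

lemma isTheta_secondCol (hp0 : p ≠ 0) (hp1 : ‖p‖ < 1) (hu0 : ∀ i, u i ≠ 0) (hL0 : L ≠ 0)
    (x y : Fin (2 * m + 3) → ℂ) {w : ℂ} (hw : w ≠ 0) :
    IsTheta p (m + 3) L (secondCol p u L x y w) := by
  have hterm : ∀ S ∈ Finset.powersetCard (m + 2) (Finset.univ : Finset (Fin (2 * m + 3))),
      IsTheta p (m + 2) (L / w) fun z =>
        (-1) ^ m * (∏ i ∈ S, x i) * (∏ i ∈ Sᶜ, y i) / (uProd u S * w) *
        (theta p (w * uProd u S / L) * theta p (w * z * uProd u Sᶜ / L)) *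
        (∏ i ∈ Sᶜ, theta p (z / u (emb m i))) * weight p u S := fun S hS => by
    have hc : w * uProd u Sᶜ / L ≠ 0 := div_ne_zero (mul_ne_zero hw (uProd_ne_zero hu0 Sᶜ)) hL0
    have h1 := isTheta_theta_mul hp0 hp1 hc
    have h2 : IsTheta p Sᶜ.card (uProd u Sᶜ) fun z => ∏ i ∈ Sᶜ, theta p (z / u (emb m i)) :=
      IsTheta.prod fun i _ => isTheta_theta_div hp0 hp1 (hu0 _)
    have h3 := ((((h1.const_mul (theta p (w * uProd u S / L))).const_mul
      ((-1) ^ m * (∏ i ∈ S, x i) * (∏ i ∈ Sᶜ, y i) / (uProd u S * w))).mul h2).mul_const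
        (weight p u S))
    rw [Finset.card_compl, (Finset.mem_powersetCard.1 hS).2, Fintype.card_fin] at h3
    have e : (w * uProd u Sᶜ / L)⁻¹ * uProd u Sᶜ = L / w := by
      have := uProd_ne_zero hu0 Sᶜ
      field_simp
    rw [e, show 1 + (2 * m + 3 - (m + 2)) = m + 2 by omega] at h3
    have e2 : ∀ z, w * z * uProd u Sᶜ / L = w * uProd u Sᶜ / L * z := fun z => by ring
    simpa only [e2] using h3
  have h := ((isTheta_theta_div hp0 hp1 hw).mul_const (theta p (u (i3 m) / w))⁻¹).mul
    (IsTheta.sum hterm)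
  rwa [mul_div_cancel₀ _ hw, show 1 + (m + 2) = m + 3 by ring] at h

lemma isThetaMatrix_matB (hp0 : p ≠ 0) (hp1 : ‖p‖ < 1) (hu0 : ∀ i, u i ≠ 0) (hL0 : L ≠ 0)
    (x y : Fin (2 * m + 3) → ℂ) : IsThetaMatrix p m L (matB p u L x y) := by
  intro i j
  fin_cases i <;> fin_cases j
  · exact isTheta_firstCol hp0 hp1 hu0 hL0 x y (hu0 (i4 m))
  · exact isTheta_secondCol hp0 hp1 hu0 hL0 x y (hu0 (i4 m))
  · exact isTheta_firstCol hp0 hp1 hu0 hL0 x y (hu0 (i5 m))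
  · exact isTheta_secondCol hp0 hp1 hu0 hL0 x y (hu0 (i5 m))

/-- Separates the factors involving `k`. The remaining double product is the same as in
`weight_insert`, so the weights of `S` and `S ∪ {k}` become comparable. -/
lemma weight_eq_of_notMem {S : Finset (Fin (2 * m + 3))} {k : Fin (2 * m + 3)} (hk : k ∉ S) :
    weight p u S = (∏ i ∈ S, (u (emb m k))⁻¹ * (theta p (u (emb m i) / u (emb m k)))⁻¹) *
      ∏ i ∈ S, ∏ j ∈ (insert k S)ᶜ,
        (u (emb m j))⁻¹ * (theta p (u (emb m i) / u (emb m j)))⁻¹ := by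
  have hS : Sᶜ = insert k (insert k S)ᶜ := by
    ext i; by_cases h : i = k <;> simp [h, hk]
  rw [weight, ← Finset.prod_mul_distrib]
  refine Finset.prod_congr rfl fun i _ => ?_
  rw [hS, Finset.prod_insert (by simp)]

lemma weight_insert {S : Finset (Fin (2 * m + 3))} {k : Fin (2 * m + 3)} (hk : k ∉ S) :
    weight p u (insert k S) =
      (∏ j ∈ (insert k S)ᶜ, (u (emb m j))⁻¹ * (theta p (u (emb m k) / u (emb m j)))⁻¹) *
      ∏ i ∈ S, ∏ j ∈ (insert k S)ᶜ,
        (u (emb m j))⁻¹ * (theta p (u (emb m i) / u (emb m j)))⁻¹ := by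
  rw [weight, Finset.prod_insert hk]

lemma uProd_compl_of_notMem {S : Finset (Fin (2 * m + 3))} {k : Fin (2 * m + 3)} (hk : k ∉ S) :
    uProd u Sᶜ = u (emb m k) * uProd u (insert k S)ᶜ := by
  have hS : Sᶜ = insert k (insert k S)ᶜ := by
    ext i; by_cases h : i = k <;> simp [h, hk]
  rw [hS, uProd_insert (by simp)]

/-- The summands for `S` and `S ∪ {k}` cancel at `z = u_k`. -/
lemma summand_add_summand_insert (hp0 : p ≠ 0) (hp1 : ‖p‖ < 1) (hu0 : ∀ i, u i ≠ 0)
    (hu : ∀ i j, i ≠ j → ∀ n : ℤ, u i ≠ p ^ n * u j)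
    (x y : Fin (2 * m + 3) → ℂ) {w : ℂ} {S : Finset (Fin (2 * m + 3))}
    (hS : S.card = m + 1) {k : Fin (2 * m + 3)} (hk : k ∉ S) :
    (∏ i ∈ S, x i) * (∏ i ∈ Sᶜ, y i) / (uProd u Sᶜ * w) *
        (theta p (uProd u S * w * u (emb m k) / L) * theta p (uProd u Sᶜ * w / L)) *
        (∏ i ∈ S, theta p (u (emb m k) / u (emb m i))) * weight p u S * x k =
    -((-1) ^ m * (∏ i ∈ insert k S, x i) * (∏ i ∈ (insert k S)ᶜ, y i) /
        (uProd u (insert k S) * w) *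
        (theta p (w * uProd u (insert k S) / L) *
          theta p (w * u (emb m k) * uProd u (insert k S)ᶜ / L)) *
        (∏ i ∈ (insert k S)ᶜ, theta p (u (emb m k) / u (emb m i))) *
          weight p u (insert k S) * y k) := by
  have hSc : Sᶜ = insert k (insert k S)ᶜ := by
    ext i; by_cases h : i = k <;> simp [h, hk]
  have hy : ∏ i ∈ Sᶜ, y i = y k * ∏ i ∈ (insert k S)ᶜ, y i := by
    rw [hSc, Finset.prod_insert (by simp)]
  have hne : ∀ i ≠ k, theta p (u (emb m i) / u (emb m k)) ≠ 0 := fun i hi =>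
    theta_div_ne_zero hp0 hp1 hu0 hu ((emb_injective m).ne hi)
  have hne' : ∀ i ≠ k, theta p (u (emb m k) / u (emb m i)) ≠ 0 := fun i hi =>
    theta_div_ne_zero hp0 hp1 hu0 hu ((emb_injective m).ne hi.symm)
  -- Each `i ∈ S` contributes one inversion of theta, hence one sign; the total `(-1)^(m+1)` is what
  -- the factor `(-1)^m` in the second column compensates.
  have h1 : (∏ i ∈ S, theta p (u (emb m k) / u (emb m i))) *
      (∏ i ∈ S, (u (emb m k))⁻¹ * (theta p (u (emb m i) / u (emb m k)))⁻¹) =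
      (-1) ^ (m + 1) * (uProd u S)⁻¹ := by
    rw [← Finset.prod_mul_distrib, uProd, ← Finset.prod_inv_distrib, ← hS, ← Finset.prod_const,
      ← Finset.prod_mul_distrib]
    refine Finset.prod_congr rfl fun i hi => ?_
    have hik : i ≠ k := fun h => hk (h ▸ hi)
    rw [theta_swap hp1 (hu0 (emb m k)) (hu0 (emb m i))]
    have := hne i hik
    have := hu0 (emb m k)
    have := hu0 (emb m i)
    field_simp
  have h2 : (∏ i ∈ (insert k S)ᶜ, theta p (u (emb m k) / u (emb m i))) *
      (∏ j ∈ (insert k S)ᶜ, (u (emb m j))⁻¹ * (theta p (u (emb m k) / u (emb m j)))⁻¹) =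
      (uProd u (insert k S)ᶜ)⁻¹ := by
    rw [← Finset.prod_mul_distrib, uProd, ← Finset.prod_inv_distrib]
    refine Finset.prod_congr rfl fun i hi => ?_
    have hik : i ≠ k := by rintro rfl; simp at hi
    have := hne' i hik
    field_simp
  rw [weight_eq_of_notMem hk, weight_insert hk, hy, Finset.prod_insert hk, uProd_insert hk,
    uProd_compl_of_notMem hk]
  have e1 : uProd u S * w * u (emb m k) / L = w * (u (emb m k) * uProd u S) / L := by ring
  have e2 : u (emb m k) * uProd u (insert k S)ᶜ * w / L =
      w * u (emb m k) * uProd u (insert k S)ᶜ / L := by ring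
  rw [e1, e2]
  generalize theta p (w * (u (emb m k) * uProd u S) / L) = A
  generalize theta p (w * u (emb m k) * uProd u (insert k S)ᶜ / L) = B
  generalize (∏ i ∈ S, ∏ j ∈ (insert k S)ᶜ,
        (u (emb m j))⁻¹ * (theta p (u (emb m i) / u (emb m j)))⁻¹) = W
  simp only [div_eq_mul_inv, mul_inv] at h1 h2 ⊢
  linear_combination
    ((∏ i ∈ S, x i) * y k * (∏ i ∈ (insert k S)ᶜ, y i) * (u (emb m k))⁻¹ *
      (uProd u (insert k S)ᶜ)⁻¹ * w⁻¹ * A * B * W * x k) * h1 +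
    ((-1) ^ m * x k * (∏ i ∈ S, x i) * y k * (∏ i ∈ (insert k S)ᶜ, y i) * (u (emb m k))⁻¹ *
      (uProd u S)⁻¹ * w⁻¹ * A * B * W) * h2

/-- At `z = u_k` the factor `θ(1) = 0` removes the sets containing `k` from the first sum and those
missing `k` from the second. The survivors cancel along `S ↔ S ∪ {k}`. -/
lemma firstCol_mul_add_secondCol_mul (hp0 : p ≠ 0) (hp1 : ‖p‖ < 1) (hu0 : ∀ i, u i ≠ 0)
    (hu : ∀ i j, i ≠ j → ∀ n : ℤ, u i ≠ p ^ n * u j)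
    (x y : Fin (2 * m + 3) → ℂ) (w : ℂ) (k : Fin (2 * m + 3)) :
    firstCol p u L x y w (u (emb m k)) * x k + secondCol p u L x y w (u (emb m k)) * y k = 0 := by
  have hkk : theta p (u (emb m k) / u (emb m k)) = 0 := by
    rw [div_self (hu0 _), theta_one hp1]
  rw [firstCol, secondCol, mul_assoc, mul_assoc, ← mul_add, Finset.sum_mul, Finset.sum_mul]
  refine mul_eq_zero_of_right _ ?_
  rw [← Finset.sum_filter_of_ne (p := fun S => k ∉ S),
    ← Finset.sum_filter_of_ne (s := Finset.powersetCard (m + 2) _) (p := fun S => k ∈ S)]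
  · rw [← sub_neg_eq_add, sub_eq_zero, ← Finset.sum_neg_distrib]
    refine Finset.sum_nbij' (fun S => insert k S) (fun S => S.erase k) ?_ ?_ ?_ ?_ ?_
    · intro S hS
      simp only [Finset.mem_filter, Finset.mem_powersetCard, Finset.subset_univ, true_and] at hS ⊢
      exact ⟨by rw [Finset.card_insert_of_notMem hS.2, hS.1], by simp⟩
    · intro S hS
      simp only [Finset.mem_filter, Finset.mem_powersetCard, Finset.subset_univ, true_and] at hS ⊢
      exact ⟨by rw [Finset.card_erase_of_mem hS.2, hS.1]; rfl, by simp⟩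
    · intro S hS
      exact Finset.erase_insert (Finset.mem_filter.1 hS).2
    · intro S hS
      exact Finset.insert_erase (Finset.mem_filter.1 hS).2
    · intro S hS
      simp only [Finset.mem_filter, Finset.mem_powersetCard, Finset.subset_univ, true_and] at hS
      exact summand_add_summand_insert hp0 hp1 hu0 hu x y hS.1 hS.2
  · intro S _ h
    by_contra hk
    apply h
    rw [Finset.prod_eq_zero (f := fun i => theta p (u (emb m k) / u (emb m i)))
      (Finset.mem_compl.2 hk) hkk]
    ring
  · intro S _ h hk
    apply h
    rw [Finset.prod_eq_zero (f := fun i => theta p (u (emb m k) / u (emb m i))) hk hkk]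
    ring

lemma matB_mulVec (hp0 : p ≠ 0) (hp1 : ‖p‖ < 1) (hu0 : ∀ i, u i ≠ 0)
    (hu : ∀ i j, i ≠ j → ∀ n : ℤ, u i ≠ p ^ n * u j)
    (x y : Fin (2 * m + 3) → ℂ) (k : Fin (2 * m + 3)) :
    (matB p u L x y (u (emb m k))).mulVec ![x k, y k] = 0 := by
  ext i
  fin_cases i <;>
    simpa [matB, Matrix.mulVec, dotProduct, Fin.sum_univ_two] using
      firstCol_mul_add_secondCol_mul hp0 hp1 hu0 hu x y _ k

lemma matB_eq_zero {x y : Fin (2 * m + 3) → ℂ} {k : Fin (2 * m + 3)} (hx : x k = 0) (hy : y k = 0)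
    (z : ℂ) : matB p u L x y z = 0 := by
  have h : ∀ S : Finset (Fin (2 * m + 3)), (∏ i ∈ S, x i) * (∏ i ∈ Sᶜ, y i) = 0 := fun S => by
    by_cases hk : k ∈ S
    · rw [Finset.prod_eq_zero hk hx, zero_mul]
    · rw [Finset.prod_eq_zero (Finset.mem_compl.2 hk) hy, mul_zero]
  have h1 : ∀ w, firstCol p u L x y w z = 0 := fun w => by
    simp [firstCol, h]
  have h2 : ∀ w, secondCol p u L x y w z = 0 := fun w => by
    simp [secondCol, h, mul_assoc ((-1 : ℂ) ^ m)]
  ext i j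
  fin_cases i <;> fin_cases j <;> simp [matB, h1, h2]

lemma matB_i4 (hp1 : ‖p‖ < 1) (hu0 : ∀ i, u i ≠ 0) (x y : Fin (2 * m + 3) → ℂ) (j : Fin 2) :
    matB p u L x y (u (i4 m)) 0 j = 0 := by
  fin_cases j <;> simp [matB, firstCol, secondCol, div_self (hu0 _), theta_one hp1]

lemma matB_i5 (hp1 : ‖p‖ < 1) (hu0 : ∀ i, u i ≠ 0) (x y : Fin (2 * m + 3) → ℂ) (j : Fin 2) :
    matB p u L x y (u (i5 m)) 1 j = 0 := by
  fin_cases j <;> simp [matB, firstCol, secondCol, div_self (hu0 _), theta_one hp1]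

/-- Because of the relation for `L²`, exchanging `v` and `w` swaps the two thetas and inverts their
arguments; the inversion factors combine to `v/w`. -/
lemma inv_mul_theta_mul_theta_eq (hp1 : ‖p‖ < 1) {a b c v w : ℂ} (ha : a ≠ 0) (hb : b ≠ 0)
    (hc : c ≠ 0) (hv : v ≠ 0) (hw : w ≠ 0) (hL0 : L ≠ 0) (h : L ^ 2 = a * b * c * v * w) :
    v⁻¹ * (theta p (a * v * c / L) * theta p (b * v / L)) =
      w⁻¹ * (theta p (a * w * c / L) * theta p (b * w / L)) := by
  have e1 : a * v * c / L = L / (b * w) := by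
    field_simp
    linear_combination -h
  have e2 : b * v / L = L / (a * w * c) := by
    field_simp
    linear_combination -h
  rw [e1, e2, theta_swap hp1 hL0 (mul_ne_zero hb hw),
    theta_swap hp1 hL0 (mul_ne_zero (mul_ne_zero ha hw) hc)]
  field_simp
  rw [h]
  ring

/-- The normalising denominator makes the prefactor 1 in both rows, and the summands agree one by
one by `inv_mul_theta_mul_theta_eq`. -/
lemma matB_i3 (hp0 : p ≠ 0) (hp1 : ‖p‖ < 1) (hu0 : ∀ i, u i ≠ 0)
    (hu : ∀ i j, i ≠ j → ∀ n : ℤ, u i ≠ p ^ n * u j) (hL : L ^ 2 = ∏ j, u j)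
    (x y : Fin (2 * m + 3) → ℂ) (j : Fin 2) :
    matB p u L x y (u (i3 m)) 0 j = matB p u L x y (u (i3 m)) 1 j := by
  have hL0 := ne_zero_of_sq_eq_prod hu0 hL
  have h4 : theta p (u (i3 m) / u (i4 m)) ≠ 0 :=
    theta_div_ne_zero hp0 hp1 hu0 hu (by simp [i3, i4])
  have h5 : theta p (u (i3 m) / u (i5 m)) ≠ 0 :=
    theta_div_ne_zero hp0 hp1 hu0 hu (by simp [i3, i5])
  have key := fun S => inv_mul_theta_mul_theta_eq hp1 (uProd_ne_zero hu0 S)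
    (uProd_ne_zero hu0 Sᶜ) (hu0 (i3 m)) (hu0 (i4 m)) (hu0 (i5 m)) hL0 (hL.trans (prod_univ_eq u S))
  fin_cases j
  · simp only [matB, firstCol, Fin.zero_eta, Matrix.of_apply, Matrix.cons_val', Matrix.cons_val_zero,
      Matrix.cons_val_one, Matrix.cons_val_fin_one, div_self h4, div_self h5]
    congr 1
    refine Finset.sum_congr rfl fun S _ => ?_
    simp only [div_eq_mul_inv, mul_inv] at key ⊢
    linear_combination ((∏ i ∈ S, x i) * (∏ i ∈ Sᶜ, y i) * (uProd u Sᶜ)⁻¹ *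
      (∏ i ∈ S, theta p (u (i3 m) * (u (emb m i))⁻¹)) * weight p u S) * key S
  · simp only [matB, secondCol, Fin.mk_one, Matrix.of_apply, Matrix.cons_val', Matrix.cons_val_zero,
      Matrix.cons_val_one, Matrix.cons_val_fin_one, div_self h4, div_self h5]
    congr 1
    refine Finset.sum_congr rfl fun S _ => ?_
    have hk := key Sᶜ
    rw [compl_compl] at hk
    have e : ∀ w, w * u (i3 m) * uProd u Sᶜ / L = uProd u Sᶜ * w * u (i3 m) / L := fun w => by ring
    have e' : ∀ w, w * uProd u S / L = uProd u S * w / L := fun w => by ring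
    simp only [e, e', div_eq_mul_inv, mul_inv] at hk ⊢
    linear_combination ((-1) ^ m * (∏ i ∈ S, x i) * (∏ i ∈ Sᶜ, y i) * (uProd u S)⁻¹ *
      (∏ i ∈ Sᶜ, theta p (u (i3 m) * (u (emb m i))⁻¹)) * weight p u S) * hk

variable (hp0 : p ≠ 0) (hp1 : ‖p‖ < 1) (hu0 : ∀ i, u i ≠ 0)
  (hu : ∀ i j, i ≠ j → ∀ n : ℤ, u i ≠ p ^ n * u j) (hL : L ^ 2 = ∏ j, u j)
include hp0 hp1 hu0 hu hL

lemma det_matB_eq_zero (x y : Fin (2 * m + 3) → ℂ) (k : Fin (2 * m + 6)) :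
    (matB p u L x y (u k)).det = 0 := by
  rcases eq_emb_or k with ⟨i, rfl⟩ | rfl | rfl | rfl
  · by_cases h : x i = 0 ∧ y i = 0
    · rw [matB_eq_zero h.1 h.2]
      simp
    · refine Matrix.exists_mulVec_eq_zero_iff.1 ⟨![x i, y i], fun hv => h ?_,
        matB_mulVec hp0 hp1 hu0 hu x y i⟩
      exact ⟨by simpa using congrFun hv 0, by simpa using congrFun hv 1⟩
  · rw [Matrix.det_fin_two, matB_i3 hp0 hp1 hu0 hu hL x y 0, matB_i3 hp0 hp1 hu0 hu hL x y 1]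
    ring
  · simp [Matrix.det_fin_two, matB_i4 hp1 hu0]
  · simp [Matrix.det_fin_two, matB_i5 hp1 hu0]

lemma det_matB_eq (x y : Fin (2 * m + 3) → ℂ) :
    ∃ C, ∀ z, z ≠ 0 → (matB p u L x y z).det = C * ∏ j, theta p (z / u j) :=
  (isThetaMatrix_matB hp0 hp1 hu0 (ne_zero_of_sq_eq_prod hu0 hL) x y).exists_det_eq
    hp0 hp1 hu0 hu hL (det_matB_eq_zero hp0 hp1 hu0 hu hL x y)

lemma det_matB_eq_zero_iff {x y : Fin (2 * m + 3) → ℂ} (h : DetNonzero (matB p u L x y)) {z : ℂ}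
    (hz : z ≠ 0) : (matB p u L x y z).det = 0 ↔ ∃ k, ∃ n : ℤ, z = p ^ n * u k := by
  obtain ⟨C, hC⟩ := det_matB_eq hp0 hp1 hu0 hu hL x y
  obtain ⟨z₀, hz₀, hd⟩ := h
  have hC0 : C ≠ 0 := by rintro rfl; exact hd (by rw [hC z₀ hz₀, zero_mul])
  rw [hC z hz, mul_eq_zero, or_iff_right hC0, prod_theta_eq_zero_iff hp0 hp1 hu0 hz]

lemma propA1_matB {x y : Fin (2 * m + 3) → ℂ} (h : DetNonzero (matB p u L x y)) :
    PropA1 u (matB p u L x y) := ⟨det_matB_eq_zero hp0 hp1 hu0 hu hL x y, h⟩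

lemma matB_ne_zero {x y : Fin (2 * m + 3) → ℂ} (h : DetNonzero (matB p u L x y))
    (k : Fin (2 * m + 6)) : matB p u L x y (u k) ≠ 0 :=
  (isThetaMatrix_matB hp0 hp1 hu0 (ne_zero_of_sq_eq_prod hu0 hL) x y).ne_zero_of_propA1
    hp0 hp1 hu0 hu hL (propA1_matB hp0 hp1 hu0 hu hL h) k

lemma propA2_matB {x y : Fin (2 * m + 3) → ℂ} (h : DetNonzero (matB p u L x y)) :
    PropA2 u x y (matB p u L x y) := by
  intro k
  refine ker_eq_span_of_mulVec (matB_ne_zero hp0 hp1 hu0 hu hL h _) (fun hv => ?_)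
    (matB_mulVec hp0 hp1 hu0 hu x y k)
  obtain ⟨z, _, hd⟩ := h
  rw [matB_eq_zero (by simpa using congrFun hv 0) (by simpa using congrFun hv 1)] at hd
  simp at hd

lemma propA3_matB {x y : Fin (2 * m + 3) → ℂ} (h : DetNonzero (matB p u L x y)) :
    PropA3 u (matB p u L x y) := by
  have hne := matB_ne_zero hp0 hp1 hu0 hu hL h
  refine ⟨range_eq_span_of_forall (hne _) (fun j => matB p u L x y (u (i3 m)) 1 j) fun j => ?_,
    range_eq_span_of_forall (hne _) (fun j => matB p u L x y (u (i4 m)) 1 j) fun j => ?_,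
    range_eq_span_of_forall (hne _) (fun j => matB p u L x y (u (i5 m)) 0 j) fun j => ?_⟩
  · simp [matB_i3 hp0 hp1 hu0 hu hL]
  · simp [matB_i4 hp1 hu0]
  · simp [matB_i5 hp1 hu0]

end

/-! ### Genericity: `det B` is not identically zero for generic `(x, y)`. -/

section

variable {p : ℂ} {m : ℕ} {u : Fin (2 * m + 6) → ℂ} {L : ℂ}

/-- The entries of `B(z)` depend polynomially on `(x, y)`. -/
lemma exists_mvPolynomial_det_matB (p : ℂ) (u : Fin (2 * m + 6) → ℂ) (L z : ℂ) :
    ∃ F : MvPolynomial (Fin (2 * m + 3) ⊕ Fin (2 * m + 3)) ℂ, ∀ x y : Fin (2 * m + 3) → ℂ,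
      MvPolynomial.eval (Sum.elim x y) F = (matB p u L x y z).det := by
  have h1 : ∀ w, ∃ F : MvPolynomial (Fin (2 * m + 3) ⊕ Fin (2 * m + 3)) ℂ,
      ∀ x y : Fin (2 * m + 3) → ℂ,
        MvPolynomial.eval (Sum.elim x y) F = firstCol p u L x y w z := fun w =>
    ⟨MvPolynomial.C (theta p (z / w) / theta p (u (i3 m) / w)) *
      ∑ S ∈ Finset.powersetCard (m + 1) Finset.univ,
        (∏ i ∈ S, MvPolynomial.X (Sum.inl i)) * (∏ i ∈ Sᶜ, MvPolynomial.X (Sum.inr i)) *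
        MvPolynomial.C (uProd u Sᶜ * w)⁻¹ *
        MvPolynomial.C (theta p (uProd u S * w * z / L) * theta p (uProd u Sᶜ * w / L)) *
        MvPolynomial.C (∏ i ∈ S, theta p (z / u (emb m i))) * MvPolynomial.C (weight p u S),
      fun x y => by
        simp only [map_mul, map_sum, map_prod, MvPolynomial.eval_C, MvPolynomial.eval_X,
          Sum.elim_inl, Sum.elim_inr, firstCol, div_eq_mul_inv]⟩
  have h2 : ∀ w, ∃ F : MvPolynomial (Fin (2 * m + 3) ⊕ Fin (2 * m + 3)) ℂ,
      ∀ x y : Fin (2 * m + 3) → ℂ,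
        MvPolynomial.eval (Sum.elim x y) F = secondCol p u L x y w z := fun w =>
    ⟨MvPolynomial.C (theta p (z / w) / theta p (u (i3 m) / w)) *
      ∑ S ∈ Finset.powersetCard (m + 2) Finset.univ,
        MvPolynomial.C ((-1) ^ m) *
        (∏ i ∈ S, MvPolynomial.X (Sum.inl i)) * (∏ i ∈ Sᶜ, MvPolynomial.X (Sum.inr i)) *
        MvPolynomial.C (uProd u S * w)⁻¹ *
        MvPolynomial.C (theta p (w * uProd u S / L) * theta p (w * z * uProd u Sᶜ / L)) *
        MvPolynomial.C (∏ i ∈ Sᶜ, theta p (z / u (emb m i))) * MvPolynomial.C (weight p u S),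
      fun x y => by
        simp only [map_mul, map_sum, map_prod, MvPolynomial.eval_C, MvPolynomial.eval_X,
          Sum.elim_inl, Sum.elim_inr, secondCol, div_eq_mul_inv]⟩
  choose F hF using h1
  choose G hG using h2
  refine ⟨F (u (i4 m)) * G (u (i5 m)) - G (u (i4 m)) * F (u (i5 m)), fun x y => ?_⟩
  simp [hF, hG, matB, Matrix.det_fin_two]

/-- The indicator of `A`. -/
def indic {ι : Type*} [DecidableEq ι] (A : Finset ι) (i : ι) : ℂ := if i ∈ A then 1 else 0

lemma prod_indic {ι : Type*} [DecidableEq ι] (A S : Finset ι) :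
    ∏ i ∈ S, indic A i = if S ⊆ A then 1 else 0 := by
  split_ifs with h
  · exact Finset.prod_eq_one fun i hi => if_pos (h hi)
  · obtain ⟨i, hi, hA⟩ := Finset.not_subset.1 h
    exact Finset.prod_eq_zero hi (if_neg hA)

/-- Used with `T = S ∪ {k}`: only `S` and `T` lie between, and having sizes `m+1` and `m+2` they
leave exactly one summand in each column. -/
lemma prod_indic_mul_prod_indic {ι : Type*} [DecidableEq ι] [Fintype ι] (S T A : Finset ι) :
    (∏ i ∈ A, indic T i) * (∏ i ∈ Aᶜ, indic Sᶜ i) = if S ⊆ A ∧ A ⊆ T then 1 else 0 := by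
  simp only [prod_indic, Finset.compl_subset_compl]
  split_ifs <;> simp_all

lemma firstCol_indic {S : Finset (Fin (2 * m + 3))} (hS : S.card = m + 1)
    (k : Fin (2 * m + 3)) (w z : ℂ) :
    firstCol p u L (indic (insert k S)) (indic Sᶜ) w z =
      theta p (z / w) / theta p (u (i3 m) / w) * (1 / (uProd u Sᶜ * w) *
        (theta p (uProd u S * w * z / L) * theta p (uProd u Sᶜ * w / L)) *
        (∏ i ∈ S, theta p (z / u (emb m i))) * weight p u S) := by
  rw [firstCol, Finset.sum_eq_single_of_mem S (by simp [hS])]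
  · rw [prod_indic_mul_prod_indic, if_pos ⟨subset_rfl, Finset.subset_insert k S⟩]
  · intro A hA hAS
    rw [prod_indic_mul_prod_indic, if_neg]
    · ring
    · rintro ⟨h, -⟩
      exact hAS (Finset.eq_of_subset_of_card_le h
        (by rw [(Finset.mem_powersetCard.1 hA).2, hS])).symm

lemma secondCol_indic {S : Finset (Fin (2 * m + 3))} (hS : S.card = m + 1)
    {k : Fin (2 * m + 3)} (hk : k ∉ S) (w z : ℂ) :
    secondCol p u L (indic (insert k S)) (indic Sᶜ) w z =
      theta p (z / w) / theta p (u (i3 m) / w) * ((-1) ^ m / (uProd u (insert k S) * w) *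
        (theta p (w * uProd u (insert k S) / L) * theta p (w * z * uProd u (insert k S)ᶜ / L)) *
        (∏ i ∈ (insert k S)ᶜ, theta p (z / u (emb m i))) * weight p u (insert k S)) := by
  have hT : (insert k S).card = m + 2 := by rw [Finset.card_insert_of_notMem hk, hS]
  rw [secondCol, Finset.sum_eq_single_of_mem (insert k S) (by simp [hT])]
  · rw [mul_assoc ((-1) ^ m), prod_indic_mul_prod_indic,
      if_pos ⟨Finset.subset_insert k S, subset_rfl⟩, mul_one]
  · intro A hA hAS
    rw [mul_assoc ((-1) ^ m), prod_indic_mul_prod_indic, if_neg]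
    · ring
    · rintro ⟨-, h⟩
      exact hAS (Finset.eq_of_subset_of_card_le h
        (by rw [(Finset.mem_powersetCard.1 hA).2, hT]))

lemma exists_zpow_mul_eq_of_theta_eq_zero (hp0 : p ≠ 0) (hp1 : ‖p‖ < 1) {a b c : ℂ} (hc : c ≠ 0)
    (ha : a ≠ 0) (hb : b ≠ 0) (h : theta p (c * a) = 0) (h' : theta p (c * b) = 0) :
    ∃ n : ℤ, a = p ^ n * b := by
  obtain ⟨k, hk⟩ := (theta_eq_zero_iff hp0 hp1 (mul_ne_zero hc ha)).1 h
  obtain ⟨l, hl⟩ := (theta_eq_zero_iff hp0 hp1 (mul_ne_zero hc hb)).1 h'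
  refine ⟨k - l, mul_left_cancel₀ hc ?_⟩
  rw [mul_left_comm, hk, hl, ← zpow_add₀ hp0, sub_add_cancel]

/-- A determinant of theta functions that does not vanish identically. -/
lemma exists_theta_mul_sub_ne_zero (hp0 : p ≠ 0) (hp1 : ‖p‖ < 1) {a r k v w : ℂ} (ha : a ≠ 0)
    (hr : r ≠ 0) (hk : k ≠ 0) (hv : v ≠ 0) (hw : w ≠ 0) (hL0 : L ≠ 0)
    (hvw : ∀ n : ℤ, v ≠ p ^ n * w) (hra : ∀ n : ℤ, r ≠ p ^ n * a) :
    ∃ z, z ≠ 0 ∧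
      theta p (a * v * z / L) * theta p (k * r * v / L) *
          (theta p (w * (k * a) / L) * theta p (w * z * r / L)) -
        theta p (a * w * z / L) * theta p (k * r * w / L) *
          (theta p (v * (k * a) / L) * theta p (v * z * r / L)) ≠ 0 := by
  have h1 : ∀ s ≠ 0, a * s * (L / (a * s)) / L = 1 := fun s hs => by field_simp
  have h2 : ∀ s t, s ≠ 0 → a * t * (L / (a * s)) / L = t / s := fun s t hs => by field_simp
  have h3 : ∀ s ≠ 0, s * (L / (a * s)) * r / L = r / a := fun s hs => by field_simp
  have hθra : theta p (r / a) ≠ 0 := fun h => by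
    obtain ⟨n, hn⟩ := (theta_div_eq_zero_iff hp0 hp1 hr ha).1 h
    exact hra n hn
  have hθvw : theta p (v / w) ≠ 0 := fun h => by
    obtain ⟨n, hn⟩ := (theta_div_eq_zero_iff hp0 hp1 hv hw).1 h
    exact hvw n hn
  have hθwv : theta p (w / v) ≠ 0 := fun h => by
    rw [theta_swap hp1 hw hv] at h
    simp_all
  have A : ∀ {s t}, s ≠ 0 → t ≠ 0 → theta p (k * r * s / L) = 0 → theta p (k * r * t / L) = 0 →
      ∃ n : ℤ, s = p ^ n * t := fun {s t} hs ht e e' =>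
    exists_zpow_mul_eq_of_theta_eq_zero hp0 hp1 (c := k * r / L) (by simp [*]) hs ht
      (by rwa [div_mul_eq_mul_div]) (by rwa [div_mul_eq_mul_div])
  have B : ∀ {s}, s ≠ 0 → theta p (k * r * s / L) = 0 → theta p (s * (k * a) / L) = 0 →
      False := fun {s} hs e e' => by
    obtain ⟨n, hn⟩ := exists_zpow_mul_eq_of_theta_eq_zero hp0 hp1 (c := k * s / L) (by simp [*])
      hr ha (by convert e using 2; ring) (by convert e' using 2; ring)
    exact hra n hn
  by_contra! H
  -- These two values of `z` kill the first and the second product respectively, so the other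
  -- product has to vanish.
  have H1 := H (L / (a * v)) (by simp [*])
  have H2 := H (L / (a * w)) (by simp [*])
  rw [h1 v hv, theta_one hp1, h2 v w hv, h3 v hv] at H1
  rw [h1 w hw, theta_one hp1, h2 w v hw, h3 w hw] at H2
  have H1' : theta p (k * r * w / L) = 0 ∨ theta p (v * (k * a) / L) = 0 := by simpa [*] using H1
  have H2' : theta p (k * r * v / L) = 0 ∨ theta p (w * (k * a) / L) = 0 := by simpa [*] using H2
  -- Each of the four combinations puts either `v/w` or `r/a` in `p^ℤ`.
  rcases H1' with e | e <;> rcases H2' with e' | e'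
  · obtain ⟨n, hn⟩ := A hv hw e' e
    exact hvw n hn
  · exact B hw e e'
  · exact B hv e' e
  · obtain ⟨n, hn⟩ := exists_zpow_mul_eq_of_theta_eq_zero hp0 hp1 (c := k * a / L) (by simp [*])
      hv hw (by convert e using 2; ring) (by convert e' using 2; ring)
    exact hvw n hn

/-- Supplies the condition `r ∉ p^ℤ a` of `exists_theta_mul_sub_ne_zero`. Exchanging `k` with some
`s ∈ S` keeps `S ∪ {k}`, hence the left side, but multiplies `u_S` by `u_k/u_s`, which is not in
`p^ℤ`; so the condition cannot fail for both choices. -/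
lemma exists_finset_uProd_ne (hp0 : p ≠ 0) (hu0 : ∀ i, u i ≠ 0)
    (hu : ∀ i j, i ≠ j → ∀ n : ℤ, u i ≠ p ^ n * u j) :
    ∃ (S : Finset (Fin (2 * m + 3))) (k : Fin (2 * m + 3)), S.card = m + 1 ∧ k ∉ S ∧
      ∀ n : ℤ, uProd u (insert k S)ᶜ ≠ p ^ n * uProd u S := by
  obtain ⟨S, -, hS⟩ := Finset.exists_subset_card_eq
    (s := (Finset.univ : Finset (Fin (2 * m + 3)))) (n := m + 1) (by simp; omega)
  obtain ⟨k, hk⟩ : ∃ k, k ∉ S := by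
    by_contra! h
    rw [Finset.eq_univ_iff_forall.2 h, Finset.card_univ, Fintype.card_fin] at hS
    omega
  obtain ⟨s, hs⟩ : S.Nonempty := Finset.card_pos.1 (by omega)
  by_contra! H
  have hks : k ≠ s := fun h => hk (h ▸ hs)
  have hk' : k ∉ S.erase s := fun h => hk (Finset.mem_of_mem_erase h)
  obtain ⟨n, hn⟩ := H S k hS hk
  obtain ⟨l, hl⟩ := H (insert k (S.erase s)) s
    (by rw [Finset.card_insert_of_notMem hk', Finset.card_erase_of_mem hs, hS]; rfl)
    (by simp [hks.symm])
  rw [Finset.insert_comm, Finset.insert_erase hs, hn, uProd_insert hk',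
    ← Finset.insert_erase hs, uProd_insert (by simp), Finset.erase_insert (by simp)] at hl
  refine hu _ _ ((emb_injective m).ne hks.symm) (l - n) ?_
  have := zpow_ne_zero n hp0
  rw [zpow_sub₀ hp0]
  field_simp
  apply mul_right_cancel₀ (uProd_ne_zero hu0 (S.erase s))
  linear_combination hl

lemma weight_ne_zero (hp0 : p ≠ 0) (hp1 : ‖p‖ < 1) (hu0 : ∀ i, u i ≠ 0)
    (hu : ∀ i j, i ≠ j → ∀ n : ℤ, u i ≠ p ^ n * u j) (S : Finset (Fin (2 * m + 3))) :
    weight p u S ≠ 0 :=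
  Finset.prod_ne_zero_iff.2 fun i hi => Finset.prod_ne_zero_iff.2 fun j hj =>
    mul_ne_zero (inv_ne_zero (hu0 _)) (inv_ne_zero (theta_div_ne_zero hp0 hp1 hu0 hu
      ((emb_injective m).ne (by rintro rfl; exact Finset.mem_compl.1 hj hi))))

lemma exists_detNonzero_matB (hp0 : p ≠ 0) (hp1 : ‖p‖ < 1) (hu0 : ∀ i, u i ≠ 0)
    (hu : ∀ i j, i ≠ j → ∀ n : ℤ, u i ≠ p ^ n * u j) (hL0 : L ≠ 0) :
    ∃ x y : Fin (2 * m + 3) → ℂ, DetNonzero (matB p u L x y) := by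
  obtain ⟨S, k, hS, hk, hSk⟩ := exists_finset_uProd_ne hp0 hu0 hu
  have h45 : i4 m ≠ i5 m := by simp [i4, i5]
  have h34 : i3 m ≠ i4 m := by simp [i3, i4]
  have h35 : i3 m ≠ i5 m := by simp [i3, i5]
  set D : ℂ → ℂ := fun z =>
    theta p (uProd u S * u (i4 m) * z / L) * theta p (uProd u Sᶜ * u (i4 m) / L) *
      (theta p (u (i5 m) * uProd u (insert k S) / L) *
        theta p (u (i5 m) * z * uProd u (insert k S)ᶜ / L)) -
    theta p (uProd u S * u (i5 m) * z / L) * theta p (uProd u Sᶜ * u (i5 m) / L) *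
      (theta p (u (i4 m) * uProd u (insert k S) / L) *
        theta p (u (i4 m) * z * uProd u (insert k S)ᶜ / L)) with hD
  have hex : ∃ z, z ≠ 0 ∧ D z ≠ 0 := by
    simp only [hD, uProd_insert hk, uProd_compl_of_notMem hk]
    exact exists_theta_mul_sub_ne_zero hp0 hp1 (uProd_ne_zero hu0 _) (uProd_ne_zero hu0 _)
      (hu0 _) (hu0 _) (hu0 _) hL0 (hu _ _ h45) hSk
  have hcont : ContinuousOn D {0}ᶜ := by
    have hθ : ∀ g : ℂ → ℂ, Continuous g → (∀ z, z ≠ 0 → g z ≠ 0) →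
        ContinuousOn (fun z => theta p (g z)) {0}ᶜ := fun g hg h =>
      (differentiableOn_theta hp1).continuousOn.comp hg.continuousOn fun z hz => h z hz
    have hS1 := uProd_ne_zero hu0 S
    have hS2 := uProd_ne_zero hu0 (insert k S)ᶜ
    have h4 := hu0 (i4 m)
    have h5 := hu0 (i5 m)
    refine ContinuousOn.sub (((hθ _ (by fun_prop) ?_).mul continuousOn_const).mul
      (continuousOn_const.mul (hθ _ (by fun_prop) ?_)))
      (((hθ _ (by fun_prop) ?_).mul continuousOn_const).mul
      (continuousOn_const.mul (hθ _ (by fun_prop) ?_))) <;>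
      intro z hz <;> simp [*, -Finset.compl_insert]
  obtain ⟨z₁, hz₁, hD₁⟩ := hex
  have hopen : {0}ᶜ ∩ D ⁻¹' {0}ᶜ ∈ 𝓝 z₁ :=
    (hcont.isOpen_inter_preimage isOpen_compl_singleton isOpen_compl_singleton).mem_nhds ⟨hz₁, hD₁⟩
  -- `D` stays nonzero near `z₁`, so `z` can be moved off the zeros of the theta prefactors.
  obtain ⟨z, ⟨hz, hθ⟩, -, hDz⟩ :=
    (dense_prod_theta_ne_zero hp0 hp1 hu0).inter_nhds_nonempty hopen
  have hDz : D z ≠ 0 := hDz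
  refine ⟨indic (insert k S), indic Sᶜ, z, hz, ?_⟩
  have hdet : (matB p u L (indic (insert k S)) (indic Sᶜ) z).det =
      (theta p (z / u (i4 m)) / theta p (u (i3 m) / u (i4 m))) *
      (theta p (z / u (i5 m)) / theta p (u (i3 m) / u (i5 m))) *
      (1 / (uProd u Sᶜ * u (i4 m))) * ((-1) ^ m / (uProd u (insert k S) * u (i5 m))) *
      (∏ i ∈ S, theta p (z / u (emb m i))) * (∏ i ∈ (insert k S)ᶜ, theta p (z / u (emb m i))) *
      weight p u S * weight p u (insert k S) * D z := by
    simp only [matB, Matrix.det_fin_two, Matrix.of_apply, Matrix.cons_val', Matrix.cons_val_zero,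
      Matrix.cons_val_one, Matrix.cons_val_fin_one, firstCol_indic hS, secondCol_indic hS hk, hD]
    simp only [div_eq_mul_inv, mul_inv]
    ring
  rw [hdet]
  have hA := uProd_ne_zero hu0 Sᶜ
  have hB := uProd_ne_zero hu0 (insert k S)
  refine mul_ne_zero (mul_ne_zero (mul_ne_zero (mul_ne_zero (mul_ne_zero (mul_ne_zero (mul_ne_zero
    (mul_ne_zero ?_ ?_) ?_) ?_) ?_) ?_) ?_) ?_) hDz
  · exact div_ne_zero (hθ _) (theta_div_ne_zero hp0 hp1 hu0 hu h34)
  · exact div_ne_zero (hθ _) (theta_div_ne_zero hp0 hp1 hu0 hu h35)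
  · simp [hA, hu0]
  · simp [hB, hu0]
  · exact Finset.prod_ne_zero_iff.2 fun i _ => hθ _
  · exact Finset.prod_ne_zero_iff.2 fun i _ => hθ _
  · exact weight_ne_zero hp0 hp1 hu0 hu _
  · exact weight_ne_zero hp0 hp1 hu0 hu _

/-- Non-vanishing of `det B` is the non-vanishing of a nonzero polynomial in `(x, y)`. -/
theorem exists_mvPolynomial_ne_zero_iff_detNonzero (hp0 : p ≠ 0) (hp1 : ‖p‖ < 1)
    (hu0 : ∀ i, u i ≠ 0) (hu : ∀ i j, i ≠ j → ∀ n : ℤ, u i ≠ p ^ n * u j)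
    (hL : L ^ 2 = ∏ j, u j) :
    ∃ F : MvPolynomial (Fin (2 * m + 3) ⊕ Fin (2 * m + 3)) ℂ, F ≠ 0 ∧
      ∀ x y : Fin (2 * m + 3) → ℂ,
        MvPolynomial.eval (Sum.elim x y) F ≠ 0 ↔ DetNonzero (matB p u L x y) := by
  -- Any point off the orbits `p^ℤ u_k` will do: as `det B` is a constant times `∏ θ(z/u_j)`, its
  -- value at `z₀` decides whether it vanishes identically.
  obtain ⟨z₀, hz₀, hθ⟩ := (dense_prod_theta_ne_zero hp0 hp1 hu0).nonempty
  obtain ⟨F, hF⟩ := exists_mvPolynomial_det_matB p u L z₀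
  have hiff : ∀ x y : Fin (2 * m + 3) → ℂ,
      MvPolynomial.eval (Sum.elim x y) F ≠ 0 ↔ DetNonzero (matB p u L x y) := fun x y => by
    rw [hF]
    refine ⟨fun h => ⟨z₀, hz₀, h⟩, fun h h0 => ?_⟩
    rw [det_matB_eq_zero_iff hp0 hp1 hu0 hu hL h hz₀,
      ← prod_theta_eq_zero_iff hp0 hp1 hu0 hz₀] at h0
    exact Finset.prod_ne_zero_iff.2 (fun i _ => hθ i) h0
  refine ⟨F, ?_, hiff⟩
  rintro rfl
  obtain ⟨x, y, h⟩ := exists_detNonzero_matB hp0 hp1 hu0 hu (ne_zero_of_sq_eq_prod hu0 hL)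
  exact (hiff x y).2 h (map_zero _)

end

end EllipticGarnier

end

theorem mainTheorem2 (p : ℂ) (hp0 : p ≠ 0) (hp1 : ‖p‖ < 1) (m : ℕ)
    (u : Fin (2 * m + 6) → ℂ) (hu0 : ∀ i, u i ≠ 0)
    (hu : ∀ i j, i ≠ j → ∀ n : ℤ, u i ≠ p ^ n * u j)
    (L : ℂ) (hL : L ^ 2 = ∏ j, u j) :
    -- the determinant of `B(z)` is not identically zero for generic `(x, y)`
    (∃ F : MvPolynomial (Fin (2 * m + 3) ⊕ Fin (2 * m + 3)) ℂ, F ≠ 0 ∧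
      ∀ x y : Fin (2 * m + 3) → ℂ,
        MvPolynomial.eval (Sum.elim x y) F ≠ 0 ↔
          EllipticGarnier.DetNonzero (EllipticGarnier.matB p u L x y)) ∧
    (∀ x y : Fin (2 * m + 3) → ℂ,
      -- the entries of `B(z)` have the fixed multiplier
      EllipticGarnier.IsThetaMatrix p m L (EllipticGarnier.matB p u L x y) ∧
      -- `B(z)` has the three properties, and its determinant has no further zeros
      (EllipticGarnier.DetNonzero (EllipticGarnier.matB p u L x y) →
        EllipticGarnier.PropA1 u (EllipticGarnier.matB p u L x y) ∧
        EllipticGarnier.PropA2 u x y (EllipticGarnier.matB p u L x y) ∧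
        EllipticGarnier.PropA3 u (EllipticGarnier.matB p u L x y) ∧
        ∀ z : ℂ, z ≠ 0 →
          ((EllipticGarnier.matB p u L x y z).det = 0 ↔ ∃ k, ∃ n : ℤ, z = p ^ n * u k)) ∧
      -- any two matrices with the three properties agree up to a scalar and define the same `A(z)`
      (∀ M N : ℂ → Matrix (Fin 2) (Fin 2) ℂ,
        EllipticGarnier.IsThetaMatrix p m L M → EllipticGarnier.PropA1 u M →
        EllipticGarnier.PropA2 u x y M → EllipticGarnier.PropA3 u M →
        EllipticGarnier.IsThetaMatrix p m L N → EllipticGarnier.PropA1 u N →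
        EllipticGarnier.PropA2 u x y N → EllipticGarnier.PropA3 u N →
        (∃ c : ℂ, c ≠ 0 ∧ ∀ z : ℂ, z ≠ 0 → N z = c • M z) ∧
        ∀ q η : ℂ, q ≠ 0 → η ≠ 0 → ∀ z : ℂ, z ≠ 0 →
          EllipticGarnier.matA q η N z = EllipticGarnier.matA q η M z)) := by
  refine ⟨EllipticGarnier.exists_mvPolynomial_ne_zero_iff_detNonzero hp0 hp1 hu0 hu hL,
    fun x y => ⟨EllipticGarnier.isThetaMatrix_matB hp0 hp1 hu0
      (EllipticGarnier.ne_zero_of_sq_eq_prod hu0 hL) x y, fun h =>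
      ⟨EllipticGarnier.propA1_matB hp0 hp1 hu0 hu hL h,
        EllipticGarnier.propA2_matB hp0 hp1 hu0 hu hL h,
        EllipticGarnier.propA3_matB hp0 hp1 hu0 hu hL h,
        fun z hz => EllipticGarnier.det_matB_eq_zero_iff hp0 hp1 hu0 hu hL h hz⟩,
      fun M N hM hM1 hM2 hM3 hN hN1 hN2 hN3 => ?_⟩⟩
  obtain ⟨c, hc, h⟩ := EllipticGarnier.exists_eq_smul_of_props hp0 hp1 hu0 hu hL
    hM hM1 hM2 hM3 hN hN1 hN2 hN3
  exact ⟨⟨c, hc, h⟩, fun q η hq hη z hz => EllipticGarnier.matA_eq_of_eq_smul hc h hq hη hz⟩
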